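/- **Conventions.** Let $C$ be a triangulated category. A weight structure $w$ on $C$ is a pair of classes of objects $C_{w\le 0}, C_{w\ge 0}$, each closed under retracts in $C$, such that $C_{w\le 0}\subset C_{w\le 0}[1]$, $C_{w\ge 0}[1]\subset C_{w\ge 0}$, $C(X,Y[1])=0$ for all $X\in C_{w\le 0}$, $Y\in C_{w\ge 0}$, and every object $M$ of $C$ lies in a distinguished triangle $X\to M\to Y[1]\to X[1]$ with $X\in C_{w\le 0}$, $Y\in C_{w\ge 0}$. Put $C_{w=0}=C_{w\le 0}\cap C_{w\ge 0}$; the heart $\underline{Hw}$ is the full subcategory on $C_{w=0}$. Let $C^+$ (resp. $C^-$) be the full subcategory of $w$-bounded below (resp. $w$-bounded above) objects, i.e. of the objects in $\bigcup_{i\in\mathbb Z}C_{w\ge 0}[i]$ (resp. $\bigcup_{i\in\mathbb Z}C_{w\le 0}[i]$); $w$ is bounded below (resp. above) if $C^+=C$ (resp. $C^-=C$). An exact functor between categories with weight structures is weight-exact if it sends the class "$\le 0$" into the class "$\le 0$" and the class "$\ge 0$" into the class "$\ge 0$". A category with a weight structure is weight-Karoubian if the heart is idempotent complete. The retraction-closure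 of a class of objects is the class of all retracts of its elements. For a class $D$ of objects of a triangulated category, $\langle D\rangle$ denotes the smallest strict full triangulated subcategory containing $D$ (the subcategory strongly generated by $D$). Let $\mathrm{Kar}(-)$ be the idempotent completion; $\mathrm{Kar}(C)$ carries its standard triangulated structure, for which $C\to\mathrm{Kar}(C)$ is exact. An idempotent extension of $C$ is a triangulated category $C'$ containing $C$ (via a fully faithful exact functor $C\to C'$) for which there is a fully faithful exact functor $C'\to\mathrm{Kar}(C)$ restricting, up to isomorphism, to the canonical embedding $C\to\mathrm{Kar}(C)$. An extension of $w$ to $C'$ is a weight structure $w'$ on $C'$ such that $C\to C'$ is weight-exact; if it exists, one says that $w$ extends to $C'$. If moreover $(C',w')$ is weight-Karoubian, it is called a weight-Karoubian extension of $(C,w)$. Put $$\mathrm{Kar}^w_{\min}(C)=\langle \mathrm{Ob}\,C\cup\mathrm{Ob}\,\mathrm{Kar}(\underline{Hw})\rangle\subset \mathrm{Kar}(C),\qquad \mathrm{Kar}^w_{\max}(C)=\langle \mathrm{Ob}\,\mathrm{Kar}(C^-)\cup\mathrm{Ob}\,\mathrm{Kar}(C^+)\rangle\subset \mathrm{Kar}(C).$$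 **Theorem.** Let $w$ be a weight structure on a triangulated category $C$, and let $C'$ be an idempotent extension of $C$. I.1. If $w'$ is an extension of $w$ to $C'$, then $C'_{w'\le 0}$ (resp. $C'_{w'\ge 0}$, $C'_{w'=0}$) is the retraction-closure of $C_{w\le 0}$ (resp. $C_{w\ge 0}$, $C_{w=0}$) in $C'$. In particular, there is at most one extension of $w$ to $C'$. I.2. An extension of $w$ to $C'$ exists if and only if $C'$ is strongly generated by $\mathrm{Ob}\,C\cup C_1\cup C_2$ for some class $C_1$ of $C'$-retracts of objects of $C^+$ and some class $C_2$ of $C'$-retracts of objects of $C^-$. II.1. An extension $w'$ of $w$ to $C'$ is bounded below (resp. above) if and only if $w$ is. II.2. If $w$ is bounded below or bounded above, then $w$ extends to every idempotent extension of $C$. III.1. One has $\mathrm{Kar}^w_{\min}(C)\subset\mathrm{Kar}^w_{\max}(C)$; both are idempotent extensions of $C$, $w$ extends uniquely to each of them, and with these extended weight structures they are weight-Karoubian extensions of $(C,w)$. III.2. If $(C',w')$ is a weight-Karoubian extension of $(C,w)$, then the heart $\underline{Hw'}$ is equivalent to $\mathrm{Kar}(\underline{Hw})$, compatibly (up to isomorphism)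 with the embeddings of $\underline{Hw}$. III.3. If $w$ extends to $C'$, then there is a fully faithful exact functor $C'\to\mathrm{Kar}^w_{\max}(C)$, compatible up to isomorphism with the embeddings of $C$, which is weight-exact for the extended weight structures. III.4. If $(C',w')$ is a weight-Karoubian extension of $(C,w)$, then there is a fully faithful weight-exact (in particular exact) functor $\mathrm{Kar}^w_{\min}(C)\to C'$, compatible up to isomorphism with the embeddings of $C$, where $\mathrm{Kar}^w_{\min}(C)$ carries the extended weight structure. -/

import Mathlib

open CategoryTheory CategoryTheory.Limits CategoryTheory.Pretriangulated
open CategoryTheory.Preadditive CategoryTheory.Idempotents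

/-! ## The triangulated structure on the idempotent completion

`Karoubi C` is the category of pairs `(X, p)` with `p` an idempotent endomorphism of `X`. When `C`
is triangulated we equip it with its standard triangulated structure, for which the
embedding `toKaroubi C : C ⥤ Karoubi C` is exact. -/

namespace KaroubiTriangulated

noncomputable section

set_option linter.unusedSectionVars false

variable {C : Type*} [Category* C] [Preadditive C]

section Shift

variable [HasShift C ℤ]

/-- The shift functors of the idempotent completion: `(X, p)⟦n⟧ = (X⟦n⟧, p⟦n⟧)`. -/
def karoubiShift (n : ℤ) : Karoubi C ⥤ Karoubi C where
  obj P := ⟨P.X⟦n⟧, P.p⟦n⟧', ((shiftFunctor C n).map_comp _ _).symm.trans (congrArg _ P.idem)⟩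
  map f := ⟨f.f⟦n⟧', by
    exact ((congrArg _ (Functor.map_comp _ _ _).symm).trans (Functor.map_comp _ _ _).symm).trans
      ((shiftFunctor C n).congr_map f.comm)⟩
  map_id _ := rfl
  map_comp f g := by
    apply Karoubi.hom_ext
    exact Functor.map_comp _ _ _

/-- The embedding `C ⥤ Karoubi C` commutes with the shifts. -/
def toKaroubiCompShiftIso (n : ℤ) :
    toKaroubi C ⋙ karoubiShift n ≅ shiftFunctor C n ⋙ toKaroubi C :=
  NatIso.ofComponents
    (fun X =>
      { hom := ⟨𝟙 (X⟦n⟧), by simp [karoubiShift]⟩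
        inv := ⟨𝟙 (X⟦n⟧), by simp [karoubiShift]⟩
        hom_inv_id := by
          apply Karoubi.hom_ext
          simp [karoubiShift]
        inv_hom_id := by
          apply Karoubi.hom_ext
          exact Category.id_comp _ })
    (fun f => by
      apply Karoubi.hom_ext
      simp [karoubiShift])

instance whiskering_full :
    ((Functor.whiskeringLeft C (Karoubi C) (Karoubi C)).obj (toKaroubi C)).Full :=
  whiskeringLeftObjToKaroubiFullyFaithful.full

instance whiskering_faithful :
    ((Functor.whiskeringLeft C (Karoubi C) (Karoubi C)).obj (toKaroubi C)).Faithful :=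
  whiskeringLeftObjToKaroubiFullyFaithful.faithful

instance : HasShift (Karoubi C) ℤ :=
  HasShift.induced (toKaroubi C) ℤ karoubiShift toKaroubiCompShiftIso

instance : (toKaroubi C).CommShift ℤ :=
  Functor.CommShift.ofInduced (toKaroubi C) ℤ karoubiShift toKaroubiCompShiftIso

lemma shift_p (P : Karoubi C) (n : ℤ) : (P⟦n⟧).p = P.p⟦n⟧' := rfl

lemma shift_f {P Q : Karoubi C} (f : P ⟶ Q) (n : ℤ) : (f⟦n⟧').f = f.f⟦n⟧' := rfl

lemma commShiftIso_hom_f (X : C) (n : ℤ) :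
    (((toKaroubi C).commShiftIso n).hom.app X).f = 𝟙 (X⟦n⟧) := rfl

lemma commShiftIso_inv_f (X : C) (n : ℤ) :
    (((toKaroubi C).commShiftIso n).inv.app X).f = 𝟙 (X⟦n⟧) := rfl

instance [∀ n : ℤ, (shiftFunctor C n).Additive] (n : ℤ) :
    (shiftFunctor (Karoubi C) n).Additive where
  map_add {X Y f g} := by
    apply Karoubi.hom_ext
    exact Functor.map_add _

end Shift

instance [HasZeroObject C] : HasZeroObject (Karoubi C) :=
  ⟨(toKaroubi C).obj (HasZeroObject.zero' C).zero,
    (toKaroubi C).map_isZero (isZero_zero C)⟩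

section Distinguished

open ZeroObject

variable [HasZeroObject C] [HasShift C ℤ] [∀ n : ℤ, (shiftFunctor C n).Additive]
  [Pretriangulated C]

/-- A triangle of the idempotent completion is distinguished if it is a retract (that is, a direct
summand) of the image of a distinguished triangle of `C`. -/
def distinguished : Set (Triangle (Karoubi C)) :=
  fun T => ∃ T' ∈ distTriang C, Nonempty (Retract T ((toKaroubi C).mapTriangle.obj T'))

lemma mem_distinguished_mk {X Y Z : Karoubi C} (f : X ⟶ Y) (g : Y ⟶ Z) (h : Z ⟶ X⟦(1 : ℤ)⟧)
    (h' : Z.X ⟶ X.X⟦(1 : ℤ)⟧) (hh : h.f = h') {A B D : C} {u : A ⟶ B} {v : B ⟶ D}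
    {w : D ⟶ A⟦(1 : ℤ)⟧} (hT : Triangle.mk u v w ∈ distTriang C)
    (i₁ : X.X ⟶ A) (i₂ : Y.X ⟶ B) (i₃ : Z.X ⟶ D)
    (r₁ : A ⟶ X.X) (r₂ : B ⟶ Y.X) (r₃ : D ⟶ Z.X)
    (hi₁ : X.p ≫ i₁ = i₁) (hi₂ : Y.p ≫ i₂ = i₂) (hi₃ : Z.p ≫ i₃ = i₃)
    (hr₁ : r₁ ≫ X.p = r₁) (hr₂ : r₂ ≫ Y.p = r₂) (hr₃ : r₃ ≫ Z.p = r₃)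
    (e₁ : i₁ ≫ r₁ = X.p) (e₂ : i₂ ≫ r₂ = Y.p) (e₃ : i₃ ≫ r₃ = Z.p)
    (ci₁ : f.f ≫ i₂ = i₁ ≫ u) (ci₂ : g.f ≫ i₃ = i₂ ≫ v)
    (ci₃ : h' ≫ i₁⟦(1 : ℤ)⟧' = i₃ ≫ w)
    (cr₁ : u ≫ r₂ = r₁ ≫ f.f) (cr₂ : v ≫ r₃ = r₂ ≫ g.f)
    (cr₃ : w ≫ r₁⟦(1 : ℤ)⟧' = r₃ ≫ h') :
    Triangle.mk f g h ∈ distinguished (C := C) := by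
  subst hh
  refine ⟨_, hT, ⟨{
    i := { hom₁ := ⟨i₁, (congrArg _ (Category.comp_id _)).trans hi₁⟩
           hom₂ := ⟨i₂, (congrArg _ (Category.comp_id _)).trans hi₂⟩
           hom₃ := ⟨i₃, (congrArg _ (Category.comp_id _)).trans hi₃⟩
           comm₁ := Karoubi.hom_ext _ _ ci₁
           comm₂ := Karoubi.hom_ext _ _ ci₂
           comm₃ := Karoubi.hom_ext _ _
            (ci₃.trans (congrArg (fun t => i₃ ≫ t) (Category.comp_id w).symm)) }
    r := { hom₁ := ⟨r₁, (Category.id_comp _).trans hr₁⟩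
           hom₂ := ⟨r₂, (Category.id_comp _).trans hr₂⟩
           hom₃ := ⟨r₃, (Category.id_comp _).trans hr₃⟩
           comm₁ := Karoubi.hom_ext _ _ cr₁
           comm₂ := Karoubi.hom_ext _ _ cr₂
           comm₃ := Karoubi.hom_ext _ _
            ((congrArg (fun t => t ≫ r₁⟦(1 : ℤ)⟧') (Category.comp_id w)).trans cr₃) }
    retract := Triangle.hom_ext _ _ (Karoubi.hom_ext _ _ e₁) (Karoubi.hom_ext _ _ e₂)
      (Karoubi.hom_ext _ _ e₃) }⟩⟩

lemma distinguished_of_retract {T₁ T₂ : Triangle (Karoubi C)} (r : Retract T₁ T₂)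
    (h : T₂ ∈ distinguished (C := C)) : T₁ ∈ distinguished (C := C) := by
  obtain ⟨T', hT', ⟨r'⟩⟩ := h
  exact ⟨T', hT', ⟨r.trans r'⟩⟩

lemma rotate_mem {T : Triangle (Karoubi C)} (hT : T ∈ distinguished (C := C)) :
    T.rotate ∈ distinguished (C := C) := by
  obtain ⟨T', hT', ⟨r⟩⟩ := hT
  exact ⟨T'.rotate, rot_of_distTriang _ hT',
    ⟨(r.map (rotate (Karoubi C))).trans
      (Retract.ofIso ((toKaroubi C).mapTriangleRotateIso.app T'))⟩⟩

lemma invRotate_mem {T : Triangle (Karoubi C)} (hT : T ∈ distinguished (C := C)) :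
    T.invRotate ∈ distinguished (C := C) := by
  obtain ⟨T', hT', ⟨r⟩⟩ := hT
  exact ⟨T'.invRotate, inv_rot_of_distTriang _ hT',
    ⟨(r.map (invRotate (Karoubi C))).trans
      (Retract.ofIso ((toKaroubi C).mapTriangleInvRotateIso.app T'))⟩⟩

lemma contractible_mem (X : Karoubi C) :
    contractibleTriangle X ∈ distinguished (C := C) := by
  have h0 : ((0 : Karoubi C).p) = 0 :=
    congrArg Karoubi.Hom.f ((isZero_zero (Karoubi C)).eq_of_src (𝟙 _) 0)
  refine mem_distinguished_mk (𝟙 X) 0 0 0 rfl (contractible_distinguished X.X) X.p X.p 0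
    X.p X.p 0 X.idem X.idem (by simp) X.idem X.idem (by simp) X.idem X.idem
    (by simp [h0]) ?_ ?_ ?_ ?_ ?_ ?_
  · exact X.idem.trans (Category.comp_id _).symm
  · exact comp_zero.trans comp_zero.symm
  · exact zero_comp.trans comp_zero.symm
  · exact (Category.id_comp _).trans X.idem.symm
  · exact comp_zero.trans comp_zero.symm
  · exact zero_comp.trans comp_zero.symm

lemma isIdempotent_of_nilpotent {R : Type*} [Ring R] (x : R)
    (hx : (x * x - x) * (x * x - x) = 0) :
    (3 * (x * x) - 2 * (x * x * x)) * (3 * (x * x) - 2 * (x * x * x)) =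
      3 * (x * x) - 2 * (x * x * x) := by
  have : (3 * (x * x) - 2 * (x * x * x)) * (3 * (x * x) - 2 * (x * x * x)) -
      (3 * (x * x) - 2 * (x * x * x)) =
      ((x * x - x) * (x * x - x)) * (4 * (x * x) - 4 * x - 3) := by
    noncomm_ring
  rw [hx, zero_mul, sub_eq_zero] at this
  exact this

/-- A pair of compatible idempotents on the first two objects of a distinguished triangle extends
to an idempotent endomorphism of the triangle. -/
lemma exists_idempotent (T : Triangle C) (hT : T ∈ distTriang C)
    (p : T.obj₁ ⟶ T.obj₁) (q : T.obj₂ ⟶ T.obj₂) (hp : p ≫ p = p) (hq : q ≫ q = q)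
    (hpq : T.mor₁ ≫ q = p ≫ T.mor₁) :
    ∃ e : T.obj₃ ⟶ T.obj₃, e ≫ e = e ∧ T.mor₂ ≫ e = q ≫ T.mor₂ ∧
      T.mor₃ ≫ p⟦(1 : ℤ)⟧' = e ≫ T.mor₃ := by
  obtain ⟨c, hc₂, hc₃⟩ := complete_distinguished_triangle_morphism T T hT hT p q hpq
  have hp' : p⟦(1 : ℤ)⟧' ≫ p⟦(1 : ℤ)⟧' = p⟦(1 : ℤ)⟧' := by rw [← Functor.map_comp, hp]
  have h₂ : T.mor₂ ≫ c ≫ c = q ≫ T.mor₂ := by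
    rw [reassoc_of% hc₂, hc₂, reassoc_of% hq]
  have h₂' : T.mor₂ ≫ c ≫ c ≫ c = q ≫ T.mor₂ := by
    rw [reassoc_of% hc₂, h₂, reassoc_of% hq]
  have h₃ : (c ≫ c) ≫ T.mor₃ = T.mor₃ ≫ p⟦(1 : ℤ)⟧' := by
    rw [Category.assoc, ← hc₃, ← reassoc_of% hc₃, hp']
  have h₃' : (c ≫ c ≫ c) ≫ T.mor₃ = T.mor₃ ≫ p⟦(1 : ℤ)⟧' := by
    rw [Category.assoc, h₃, ← reassoc_of% hc₃, hp']
  obtain ⟨k, hk⟩ := T.yoneda_exact₃ hT (c ≫ c - c) (by rw [comp_sub, h₂, hc₂, sub_self])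
  have hnil : (c ≫ c - c) ≫ (c ≫ c - c) = 0 := by
    nth_rw 2 [hk]
    rw [← Category.assoc, sub_comp, h₃, ← hc₃, sub_self, zero_comp]
  let x : End T.obj₃ := c
  have key := isIdempotent_of_nilpotent x hnil
  have e_eq : (3 * (x * x) - 2 * (x * x * x) : End T.obj₃) =
      (c ≫ c + c ≫ c + c ≫ c) - (c ≫ c ≫ c + c ≫ c ≫ c) := by
    change (3 * (x * x) - 2 * (x * x * x) : End T.obj₃) =
      ((x * x) + (x * x) + (x * x)) - ((x * x * x) + (x * x * x))
    noncomm_ring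
  rw [e_eq] at key
  refine ⟨_, key, ?_, ?_⟩
  · simp only [comp_sub, comp_add, h₂, h₂']
    abel
  · simp only [sub_comp, add_comp, h₃, h₃']
    abel

/-- The retract of a distinguished triangle given by an idempotent endomorphism of it. -/
lemma mem_of_idempotent {X Y Z : Karoubi C} (f : X ⟶ Y) (g : Y ⟶ Z) (h : Z ⟶ X⟦(1 : ℤ)⟧)
    (h' : Z.X ⟶ X.X⟦(1 : ℤ)⟧) (hh : h.f = h') {u : X.X ⟶ Y.X} {v : Y.X ⟶ Z.X}
    {w : Z.X ⟶ X.X⟦(1 : ℤ)⟧} (hT : Triangle.mk u v w ∈ distTriang C)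
    (hf₁ : X.p ≫ u = f.f) (hf₂ : u ≫ Y.p = f.f) (hg₁ : Y.p ≫ v = g.f) (hg₂ : v ≫ Z.p = g.f)
    (hh₁ : Z.p ≫ w = h') (hh₂ : w ≫ X.p⟦(1 : ℤ)⟧' = h') :
    Triangle.mk f g h ∈ distinguished (C := C) :=
  mem_distinguished_mk f g h h' hh hT X.p Y.p Z.p X.p Y.p Z.p
    X.idem Y.idem Z.idem X.idem Y.idem Z.idem X.idem Y.idem Z.idem
    (by rw [Karoubi.comp_p, hf₁]) (by rw [Karoubi.comp_p, hg₁])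
    (by
      rw [hh₁, ← hh₂, Category.assoc, ← Functor.map_comp, X.idem])
    (by rw [Karoubi.p_comp, hf₂]) (by rw [Karoubi.p_comp, hg₂])
    (by rw [hh₂, ← hh₁, reassoc_of% Z.idem])

/-- The data of a cone of a morphism of `Karoubi C` on the level of `C`. -/
lemma exists_cone {X Y : Karoubi C} (f : X ⟶ Y) :
    ∃ (Z : Karoubi C) (v : Y.X ⟶ Z.X) (w : Z.X ⟶ X.X⟦(1 : ℤ)⟧),
      Triangle.mk f.f v w ∈ distTriang C ∧ v ≫ Z.p = Y.p ≫ v ∧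
      w ≫ X.p⟦(1 : ℤ)⟧' = Z.p ≫ w := by
  obtain ⟨D, v, w, hT⟩ := distinguished_cocone_triangle f.f
  obtain ⟨e, he, h₂, h₃⟩ := exists_idempotent _ hT X.p Y.p X.idem Y.idem
    ((Karoubi.comp_p f).trans (Karoubi.p_comp f).symm)
  exact ⟨⟨D, e, he⟩, v, w, hT, h₂, h₃⟩

/-- The second morphism of the triangle obtained from `exists_cone`. -/
def coneMor₂ {Y Z : Karoubi C} (v : Y.X ⟶ Z.X) (hv : v ≫ Z.p = Y.p ≫ v) : Y ⟶ Z :=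
  ⟨v ≫ Z.p, by rw [Category.assoc, Z.idem, hv, reassoc_of% Y.idem]⟩

/-- The third morphism of the triangle obtained from `exists_cone`. -/
def coneMor₃ {X Z : Karoubi C} (w : Z.X ⟶ X.X⟦(1 : ℤ)⟧) (hw : w ≫ X.p⟦(1 : ℤ)⟧' = Z.p ≫ w) :
    Z ⟶ X⟦(1 : ℤ)⟧ :=
  ⟨Z.p ≫ w, by
    change Z.p ≫ (Z.p ≫ w) ≫ X.p⟦(1 : ℤ)⟧' = Z.p ≫ w
    rw [Category.assoc, hw, reassoc_of% Z.idem, reassoc_of% Z.idem]⟩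

lemma cone_mem {X Y Z : Karoubi C} (f : X ⟶ Y) (v : Y.X ⟶ Z.X) (w : Z.X ⟶ X.X⟦(1 : ℤ)⟧)
    (hT : Triangle.mk f.f v w ∈ distTriang C) (hv : v ≫ Z.p = Y.p ≫ v)
    (hw : w ≫ X.p⟦(1 : ℤ)⟧' = Z.p ≫ w) :
    Triangle.mk f (coneMor₂ v hv) (coneMor₃ w hw) ∈ distinguished (C := C) :=
  mem_of_idempotent f _ _ (Z.p ≫ w) rfl hT (Karoubi.p_comp f) (Karoubi.comp_p f)
    hv.symm rfl rfl hw

lemma retract_square {K : Type*} [Category* K] {X₁ X₂ Y₁ Y₂ A₁ A₂ B₁ B₂ : K} {u : X₁ ⟶ X₂}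
    {u' : Y₁ ⟶ Y₂} {U : A₁ ⟶ A₂} {U' : B₁ ⟶ B₂} {r₁ : A₁ ⟶ X₁} {r₂ : A₂ ⟶ X₂} {i₁ : Y₁ ⟶ B₁}
    {i₂ : Y₂ ⟶ B₂} {a : X₁ ⟶ Y₁} {b : X₂ ⟶ Y₂} (h₁ : U ≫ r₂ = r₁ ≫ u)
    (h₂ : u' ≫ i₂ = i₁ ≫ U') (h : u ≫ b = a ≫ u') :
    U ≫ (r₂ ≫ b ≫ i₂) = (r₁ ≫ a ≫ i₁) ≫ U' := by
  rw [reassoc_of% h₁, Category.assoc, Category.assoc, ← h₂, reassoc_of% h]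

lemma retract_conj {K : Type*} [Category* K] {X Y A B : K} {i : X ⟶ A} {r : A ⟶ X} {j : Y ⟶ B}
    {t : B ⟶ Y} (h : i ≫ r = 𝟙 X) (h' : j ≫ t = 𝟙 Y) (a : X ⟶ Y) :
    i ≫ (r ≫ a ≫ j) ≫ t = a := by
  rw [Category.assoc, Category.assoc, h', reassoc_of% h, Category.comp_id]

lemma complete_mem (T₁ T₂ : Triangle (Karoubi C)) (h₁ : T₁ ∈ distinguished (C := C))
    (h₂ : T₂ ∈ distinguished (C := C)) (a : T₁.obj₁ ⟶ T₂.obj₁) (b : T₁.obj₂ ⟶ T₂.obj₂)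
    (hab : T₁.mor₁ ≫ b = a ≫ T₂.mor₁) :
    ∃ c : T₁.obj₃ ⟶ T₂.obj₃, T₁.mor₂ ≫ c = b ≫ T₂.mor₂ ∧
      T₁.mor₃ ≫ a⟦(1 : ℤ)⟧' = c ≫ T₂.mor₃ := by
  obtain ⟨T₁', hT₁, ⟨s⟩⟩ := h₁
  obtain ⟨T₂', hT₂, ⟨t⟩⟩ := h₂
  have s₁ : s.i.hom₁ ≫ s.r.hom₁ = 𝟙 _ := congrArg TriangleMorphism.hom₁ s.retract
  have s₂ : s.i.hom₂ ≫ s.r.hom₂ = 𝟙 _ := congrArg TriangleMorphism.hom₂ s.retract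
  have t₁ : t.i.hom₁ ≫ t.r.hom₁ = 𝟙 _ := congrArg TriangleMorphism.hom₁ t.retract
  have t₂ : t.i.hom₂ ≫ t.r.hom₂ = 𝟙 _ := congrArg TriangleMorphism.hom₂ t.retract
  obtain ⟨a', ha'⟩ := (toKaroubi C).map_surjective (s.r.hom₁ ≫ a ≫ t.i.hom₁)
  obtain ⟨b', hb'⟩ := (toKaroubi C).map_surjective (s.r.hom₂ ≫ b ≫ t.i.hom₂)
  have sc : ((toKaroubi C).map T₁'.mor₁) ≫ s.r.hom₂ = s.r.hom₁ ≫ T₁.mor₁ := s.r.comm₁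
  have tc : T₂.mor₁ ≫ t.i.hom₂ = t.i.hom₁ ≫ ((toKaroubi C).map T₂'.mor₁) := t.i.comm₁
  have comm : T₁'.mor₁ ≫ b' = a' ≫ T₂'.mor₁ := by
    apply (toKaroubi C).map_injective
    rw [Functor.map_comp, Functor.map_comp, ha', hb']
    exact retract_square sc tc hab
  obtain ⟨c', hc₂, hc₃⟩ := complete_distinguished_triangle_morphism _ _ hT₁ hT₂ a' b' comm
  let φ : T₁' ⟶ T₂' := { hom₁ := a', hom₂ := b', hom₃ := c', comm₁ := comm, comm₂ := hc₂,
                         comm₃ := hc₃ }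
  let ψ : T₁ ⟶ T₂ := s.i ≫ (toKaroubi C).mapTriangle.map φ ≫ t.r
  have h1 : ψ.hom₁ = a := by
    change s.i.hom₁ ≫ (toKaroubi C).map a' ≫ t.r.hom₁ = a
    rw [ha']
    exact retract_conj s₁ t₁ a
  have h2 : ψ.hom₂ = b := by
    change s.i.hom₂ ≫ (toKaroubi C).map b' ≫ t.r.hom₂ = b
    rw [hb']
    exact retract_conj s₂ t₂ b
  exact ⟨ψ.hom₃, h2 ▸ ψ.comm₂, h1 ▸ ψ.comm₃⟩

instance : Pretriangulated (Karoubi C) where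
  distinguishedTriangles := distinguished
  isomorphic_distinguished _ h _ e := distinguished_of_retract (Retract.ofIso e) h
  contractible_distinguished := contractible_mem
  distinguished_cocone_triangle f := by
    obtain ⟨Z, v, w, hT, hv, hw⟩ := exists_cone f
    exact ⟨Z, coneMor₂ v hv, coneMor₃ w hw, cone_mem f v w hT hv hw⟩
  rotate_distinguished_triangle T :=
    ⟨rotate_mem, fun h => distinguished_of_retract
      (Retract.ofIso ((triangleRotation (Karoubi C)).unitIso.app T)) (invRotate_mem h)⟩
  complete_distinguished_triangle_morphism := complete_mem

instance : (toKaroubi C).IsTriangulated where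
  map_distinguished T hT := ⟨T, hT, ⟨Retract.refl _⟩⟩

lemma octahedron_aux {X Y Z A B D : C} {f : X ⟶ Y} {g : Y ⟶ Z} {v₁₂ : Y ⟶ A}
    {w₁₂ : A ⟶ X⟦(1 : ℤ)⟧} {v₂₃ : Z ⟶ B} {w₂₃ : B ⟶ Y⟦(1 : ℤ)⟧} {v₁₃ : Z ⟶ D}
    {w₁₃ : D ⟶ X⟦(1 : ℤ)⟧} (h₁₂ : Triangle.mk f v₁₂ w₁₂ ∈ distTriang C)
    (h₂₃ : Triangle.mk g v₂₃ w₂₃ ∈ distTriang C)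
    (h₁₃ : Triangle.mk (f ≫ g) v₁₃ w₁₃ ∈ distTriang C)
    (O : Triangulated.Octahedron rfl h₁₂ h₂₃ h₁₃)
    {p : X ⟶ X} {q : Y ⟶ Y} {r : Z ⟶ Z} {a : A ⟶ A} {b : B ⟶ B} {d : D ⟶ D}
    (hp : p ≫ p = p) (hr : r ≫ r = r)
    (ha : a ≫ a = a) (hb : b ≫ b = b) (hd : d ≫ d = d)
    (hpf : p ≫ f = f) (hfq : f ≫ q = f) (hqg : q ≫ g = g) (hgr : g ≫ r = g)
    (hv₁₂ : v₁₂ ≫ a = q ≫ v₁₂) (hw₁₂ : w₁₂ ≫ p⟦(1 : ℤ)⟧' = a ≫ w₁₂)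
    (hv₂₃ : v₂₃ ≫ b = r ≫ v₂₃) (hw₂₃ : w₂₃ ≫ q⟦(1 : ℤ)⟧' = b ≫ w₂₃)
    (hv₁₃ : v₁₃ ≫ d = r ≫ v₁₃) (hw₁₃ : w₁₃ ≫ p⟦(1 : ℤ)⟧' = d ≫ w₁₃) :
    ∃ i s : D ⟶ D, d ≫ i = i ∧ s ≫ d = s ∧ i ≫ s = d ∧
      (a ≫ O.m₁ ≫ d) ≫ i = a ≫ O.m₁ ∧ (d ≫ O.m₃ ≫ b) ≫ b = i ≫ O.m₃ ∧
      O.m₁ ≫ s = a ≫ a ≫ O.m₁ ≫ d ∧ O.m₃ ≫ b = s ≫ d ≫ O.m₃ ≫ b := by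
  obtain ⟨P, hP⟩ : ∃ P, P = p⟦(1 : ℤ)⟧' := ⟨_, rfl⟩
  obtain ⟨Q, hQ⟩ : ∃ Q, Q = q⟦(1 : ℤ)⟧' := ⟨_, rfl⟩
  obtain ⟨F, hF⟩ : ∃ F, F = f⟦(1 : ℤ)⟧' := ⟨_, rfl⟩
  have hPP : P ≫ P = P := by rw [hP, ← Functor.map_comp, hp]
  have hPF : P ≫ F = F := by rw [hP, hF, ← Functor.map_comp, hpf]
  have hFQ : F ≫ Q = F := by rw [hF, hQ, ← Functor.map_comp, hfq]
  rw [← hP] at hw₁₂ hw₁₃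
  rw [← hQ] at hw₂₃
  have o₁ : v₁₂ ≫ O.m₁ = g ≫ v₁₃ := O.comm₁
  have o₂ : O.m₁ ≫ w₁₃ = w₁₂ := O.comm₂
  have o₃ : v₁₃ ≫ O.m₃ = v₂₃ := O.comm₃
  have o₄ : w₁₃ ≫ F = O.m₃ ≫ w₂₃ := hF ▸ O.comm₄
  have o₅ : O.m₁ ≫ O.m₃ = 0 := comp_distTriang_mor_zero₁₂ _ O.mem
  have z₁₃ : v₁₃ ≫ w₁₃ = 0 := comp_distTriang_mor_zero₂₃ _ h₁₃
  generalize O.m₁ = m₁ at *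
  generalize O.m₃ = m₃ at *
  -- the complementary splittings
  obtain ⟨π₀, hπ₀⟩ : ∃ π₀ : B ⟶ Z, 𝟙 Z - r = v₂₃ ≫ π₀ :=
    Triangle.yoneda_exact₂ _ h₂₃ (𝟙 Z - r)
      (show g ≫ (𝟙 Z - r) = 0 by rw [comp_sub, hgr, Category.comp_id, sub_self])
  obtain ⟨σ₀, hσ₀⟩ : ∃ σ₀ : X⟦(1 : ℤ)⟧ ⟶ A, 𝟙 _ - P = σ₀ ≫ w₁₂ :=
    Triangle.coyoneda_exact₁ _ h₁₂ (𝟙 _ - P)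
      (show (𝟙 _ - P) ≫ f⟦(1 : ℤ)⟧' = 0 by
        rw [← hF, sub_comp, hPF, Category.id_comp, sub_self])
  obtain ⟨π, hπ, bπ, πr⟩ : ∃ π : B ⟶ Z, v₂₃ ≫ π = 𝟙 Z - r ∧ b ≫ π = 0 ∧ π ≫ r = 0 := by
    refine ⟨(𝟙 _ - b) ≫ π₀ ≫ (𝟙 _ - r), ?_, ?_, ?_⟩
    · have : v₂₃ ≫ (𝟙 _ - b) = (𝟙 _ - r) ≫ v₂₃ := by
        rw [comp_sub, hv₂₃, sub_comp, Category.comp_id, Category.id_comp]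
      rw [reassoc_of% this, ← reassoc_of% hπ₀]
      simp [hr]
    · rw [← Category.assoc, comp_sub, hb, Category.comp_id, sub_self, zero_comp]
    · simp [hr]
  obtain ⟨σ, hσ, Pσ, σa⟩ : ∃ σ : X⟦(1 : ℤ)⟧ ⟶ A, σ ≫ w₁₂ = 𝟙 _ - P ∧ P ≫ σ = 0 ∧
      σ ≫ a = 0 := by
    refine ⟨(𝟙 _ - P) ≫ σ₀ ≫ (𝟙 _ - a), ?_, ?_, ?_⟩
    · have : (𝟙 _ - a) ≫ w₁₂ = w₁₂ ≫ (𝟙 _ - P) := by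
        rw [comp_sub, hw₁₂, sub_comp, Category.comp_id, Category.id_comp]
      rw [Category.assoc, Category.assoc, this, ← reassoc_of% hσ₀]
      simp [hPP]
    · rw [← Category.assoc, comp_sub, hPP, Category.comp_id, sub_self, zero_comp]
    · simp [ha]
  refine ⟨d - d ≫ m₃ ≫ π ≫ v₁₃, d - w₁₃ ≫ σ ≫ m₁ ≫ d, ?_, ?_, ?_, ?_, ?_, ?_, ?_⟩
  · rw [comp_sub, hd, reassoc_of% hd]
  · simp only [sub_comp, Category.assoc, hd]
  · have e1 : π ≫ v₁₃ ≫ d = 0 := by rw [hv₁₃, reassoc_of% πr, zero_comp]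
    have e2 : d ≫ w₁₃ ≫ σ = 0 := by rw [← reassoc_of% hw₁₃, Pσ, comp_zero]
    simp only [sub_comp, comp_sub, Category.assoc, hd, e1, reassoc_of% e2, reassoc_of% z₁₃,
      comp_zero, zero_comp, sub_zero]
  · obtain ⟨κ, hκ⟩ : ∃ κ : A ⟶ Z, a ≫ m₁ ≫ (𝟙 _ - d) = κ ≫ v₁₃ :=
      Triangle.coyoneda_exact₃ _ h₁₃ (a ≫ m₁ ≫ (𝟙 _ - d))
        (show (a ≫ m₁ ≫ (𝟙 _ - d)) ≫ w₁₃ = 0 by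
          simp only [Category.assoc, sub_comp, comp_sub, Category.id_comp, ← hw₁₃,
            reassoc_of% o₂, o₂]
          rw [hw₁₂, reassoc_of% ha, sub_self])
    have hκ' : a ≫ m₁ ≫ (𝟙 _ - d) = κ ≫ (𝟙 _ - r) ≫ v₁₃ := by
      have : (𝟙 _ - r) ≫ v₁₃ = v₁₃ ≫ (𝟙 _ - d) := by
        rw [comp_sub, hv₁₃, sub_comp, Category.comp_id, Category.id_comp]
      rw [this, ← reassoc_of% hκ]
      simp [hd]
    have key : (a ≫ m₁ ≫ (𝟙 _ - d)) ≫ m₃ ≫ π ≫ v₁₃ = a ≫ m₁ ≫ (𝟙 _ - d) := by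
      have rr : (𝟙 Z - r) ≫ (𝟙 Z - r) = 𝟙 Z - r := by simp [hr]
      rw [hκ', Category.assoc, Category.assoc, reassoc_of% o₃, reassoc_of% hπ, reassoc_of% rr]
    simp only [Category.assoc, comp_sub, sub_comp, Category.comp_id, Category.id_comp, hd,
      reassoc_of% hd, reassoc_of% o₅, zero_comp, comp_zero, zero_sub] at key ⊢
    rw [sub_eq_add_neg, key]
    abel
  · obtain ⟨τ, hτ⟩ : ∃ τ : Y⟦(1 : ℤ)⟧ ⟶ B, 𝟙 _ - b - π ≫ v₂₃ = w₂₃ ≫ τ :=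
      Triangle.yoneda_exact₃ _ h₂₃ (𝟙 _ - b - π ≫ v₂₃)
        (show v₂₃ ≫ (𝟙 _ - b - π ≫ v₂₃) = 0 by
          simp only [comp_sub, reassoc_of% hπ, hv₂₃, sub_comp, Category.comp_id,
            Category.id_comp, sub_self])
    have hτ' : 𝟙 _ - b - π ≫ v₂₃ = w₂₃ ≫ (𝟙 _ - Q) ≫ τ := by
      have e1 : w₂₃ ≫ (𝟙 _ - Q) = (𝟙 _ - b) ≫ w₂₃ := by
        rw [comp_sub, hw₂₃, sub_comp, Category.comp_id, Category.id_comp]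
      rw [reassoc_of% e1, ← hτ]
      simp [hb, reassoc_of% bπ]
    have key : d ≫ m₃ ≫ (𝟙 _ - b - π ≫ v₂₃) = 0 := by
      rw [hτ', ← reassoc_of% o₄]
      simp [reassoc_of% hFQ]
    simp only [Category.assoc, comp_sub, sub_comp, Category.comp_id, hb, o₃] at key ⊢
    rw [sub_right_comm, sub_eq_zero] at key
    exact key.symm
  · obtain ⟨τ, hτ⟩ : ∃ τ : A ⟶ Y, 𝟙 _ - a - w₁₂ ≫ σ = τ ≫ v₁₂ :=
      Triangle.coyoneda_exact₃ _ h₁₂ (𝟙 _ - a - w₁₂ ≫ σ)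
        (show (𝟙 _ - a - w₁₂ ≫ σ) ≫ w₁₂ = 0 by
          simp only [sub_comp, Category.assoc, hσ, comp_sub, hw₁₂, Category.comp_id,
            Category.id_comp, sub_self])
    have hτ' : 𝟙 _ - a - w₁₂ ≫ σ = τ ≫ (𝟙 _ - q) ≫ v₁₂ := by
      have e1 : (𝟙 _ - q) ≫ v₁₂ = v₁₂ ≫ (𝟙 _ - a) := by
        rw [comp_sub, hv₁₂, sub_comp, Category.comp_id, Category.id_comp]
      rw [e1, ← reassoc_of% hτ]
      simp [ha, σa]
    have key : (𝟙 _ - a - w₁₂ ≫ σ) ≫ m₁ ≫ d = 0 := by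
      rw [hτ', Category.assoc, Category.assoc, reassoc_of% o₁]
      simp [reassoc_of% hqg]
    simp only [Category.assoc, comp_sub, sub_comp, Category.id_comp, reassoc_of% ha,
      reassoc_of% o₂] at key ⊢
    rw [sub_right_comm, sub_eq_zero] at key
    exact key
  · obtain ⟨ρ, hρ⟩ : ∃ ρ : X⟦(1 : ℤ)⟧ ⟶ B, (𝟙 _ - d) ≫ m₃ ≫ b = w₁₃ ≫ ρ :=
      Triangle.yoneda_exact₃ _ h₁₃ ((𝟙 _ - d) ≫ m₃ ≫ b)
        (show v₁₃ ≫ (𝟙 _ - d) ≫ m₃ ≫ b = 0 by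
          simp only [sub_comp, comp_sub, Category.id_comp, reassoc_of% hv₁₃, reassoc_of% o₃,
            hv₂₃, reassoc_of% hr, sub_self])
    have hρ' : (𝟙 _ - d) ≫ m₃ ≫ b = w₁₃ ≫ (𝟙 _ - P) ≫ ρ := by
      have e1 : w₁₃ ≫ (𝟙 _ - P) = (𝟙 _ - d) ≫ w₁₃ := by
        rw [comp_sub, hw₁₃, sub_comp, Category.comp_id, Category.id_comp]
      rw [reassoc_of% e1, ← hρ]
      simp [reassoc_of% hd]
    have key : w₁₃ ≫ σ ≫ m₁ ≫ (𝟙 _ - d) ≫ m₃ ≫ b = (𝟙 _ - d) ≫ m₃ ≫ b := by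
      rw [hρ', reassoc_of% o₂, reassoc_of% hσ]
      simp [reassoc_of% hPP]
    simp only [Category.assoc, comp_sub, sub_comp, Category.id_comp, hd,
      reassoc_of% hd, reassoc_of% o₅, zero_comp, comp_zero, zero_sub, comp_neg] at key ⊢
    rw [sub_eq_add_neg, key]
    abel

instance [IsTriangulated C] : IsTriangulated (Karoubi C) :=
  IsTriangulated.mk' (fun X Y Z f g => by
    obtain ⟨A, v₁₂, w₁₂, h₁₂, hv₁₂, hw₁₂⟩ := exists_cone f
    obtain ⟨B, v₂₃, w₂₃, h₂₃, hv₂₃, hw₂₃⟩ := exists_cone g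
    obtain ⟨D, v₁₃, w₁₃, h₁₃, hv₁₃, hw₁₃⟩ := exists_cone (f ≫ g)
    have O := Triangulated.someOctahedron (rfl : f.f ≫ g.f = f.f ≫ g.f) h₁₂ h₂₃ h₁₃
    obtain ⟨i, s, hdi, hsd, his, c₁, c₂, c₃, c₄⟩ := octahedron_aux h₁₂ h₂₃ h₁₃ O X.idem Z.idem
      A.idem B.idem D.idem (Karoubi.p_comp f) (Karoubi.comp_p f) (Karoubi.p_comp g)
      (Karoubi.comp_p g) hv₁₂ hw₁₂ hv₂₃ hw₂₃ hv₁₃ hw₁₃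
    have o₁ : v₁₂ ≫ O.m₁ = g.f ≫ v₁₃ := O.comm₁
    have o₂ : O.m₁ ≫ w₁₃ = w₁₂ := O.comm₂
    have o₃ : v₁₃ ≫ O.m₃ = v₂₃ := O.comm₃
    have o₄ : w₁₃ ≫ f.f⟦(1 : ℤ)⟧' = O.m₃ ≫ w₂₃ := O.comm₄
    let m₁ : A ⟶ D := ⟨A.p ≫ O.m₁ ≫ D.p, by simp⟩
    let m₃ : D ⟶ B := ⟨D.p ≫ O.m₃ ≫ B.p, by simp⟩
    refine ⟨X, Y, Z, A, B, D, f, g, Iso.refl _, Iso.refl _, Iso.refl _,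
      by simp, by simp, coneMor₂ v₁₂ hv₁₂, coneMor₃ w₁₂ hw₁₂, cone_mem _ _ _ h₁₂ _ _,
      coneMor₂ v₂₃ hv₂₃, coneMor₃ w₂₃ hw₂₃, cone_mem _ _ _ h₂₃ _ _,
      coneMor₂ v₁₃ hv₁₃, coneMor₃ w₁₃ hw₁₃, cone_mem _ _ _ h₁₃ _ _, ⟨⟨m₁, m₃, ?_, ?_, ?_, ?_,
      ?_⟩⟩⟩
    · apply Karoubi.hom_ext
      change (v₁₂ ≫ A.p) ≫ A.p ≫ O.m₁ ≫ D.p = g.f ≫ v₁₃ ≫ D.p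
      rw [Category.assoc, reassoc_of% A.idem, reassoc_of% hv₁₂, reassoc_of% o₁,
        Karoubi.p_comp_assoc]
    · apply Karoubi.hom_ext
      change (A.p ≫ O.m₁ ≫ D.p) ≫ D.p ≫ w₁₃ = A.p ≫ w₁₂
      rw [Category.assoc, Category.assoc, reassoc_of% D.idem, ← hw₁₃, reassoc_of% o₂, hw₁₂,
        reassoc_of% A.idem]
    · apply Karoubi.hom_ext
      change (v₁₃ ≫ D.p) ≫ D.p ≫ O.m₃ ≫ B.p = v₂₃ ≫ B.p
      rw [Category.assoc, reassoc_of% D.idem, reassoc_of% hv₁₃, reassoc_of% o₃, hv₂₃,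
        reassoc_of% Z.idem]
    · apply Karoubi.hom_ext
      change (D.p ≫ w₁₃) ≫ f.f⟦(1 : ℤ)⟧' = (D.p ≫ O.m₃ ≫ B.p) ≫ B.p ≫ w₂₃
      simp only [Category.assoc]
      rw [reassoc_of% B.idem, ← hw₂₃, ← reassoc_of% o₄, ← Functor.map_comp, Karoubi.comp_p]
    · refine mem_distinguished_mk m₁ m₃ _ ((B.p ≫ w₂₃) ≫ (v₁₂ ≫ A.p)⟦(1 : ℤ)⟧') rfl O.mem
        A.p i B.p A.p s B.p A.idem hdi B.idem A.idem hsd B.idem A.idem his B.idem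
        c₁ c₂ ?_ c₃ c₄ ?_
      · rw [Category.assoc, Category.assoc, ← Functor.map_comp, Category.assoc, A.idem, hv₁₂,
          Functor.map_comp, reassoc_of% hw₂₃, reassoc_of% B.idem]
      · rw [Category.assoc, Category.assoc, ← Functor.map_comp, reassoc_of% B.idem, hv₁₂,
          Functor.map_comp, reassoc_of% hw₂₃, reassoc_of% B.idem])

end Distinguished

end

end KaroubiTriangulated

/-! ## Strongly generated subcategories -/

section Generation

variable {C : Type*} [Category* C] [Preadditive C] [HasZeroObject C] [HasShift C ℤ]
  [∀ n : ℤ, (shiftFunctor C n).Additive] [Pretriangulated C]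

/-- The class of objects of the smallest strict full triangulated subcategory `⟨D⟩` of `C`
containing a class of objects `D`, i.e. of the subcategory strongly generated by `D`. -/
def strongClosure (D : ObjectProperty C) : ObjectProperty C := fun X =>
  ∀ P : ObjectProperty C, P.IsTriangulated → P.IsClosedUnderIsomorphisms → D ≤ P → P X

lemma le_strongClosure (D : ObjectProperty C) : D ≤ strongClosure D :=
  fun _ hX _ _ _ h => h _ hX

lemma strongClosure_le {D P : ObjectProperty C} [hP : P.IsTriangulated]
    [hP' : P.IsClosedUnderIsomorphisms] (h : D ≤ P) : strongClosure D ≤ P :=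
  fun _ hX => hX P hP hP' h

instance (D : ObjectProperty C) : (strongClosure D).IsClosedUnderIsomorphisms where
  of_iso e hX P hP hP' h := P.prop_of_iso e (hX P hP hP' h)

instance (D : ObjectProperty C) : (strongClosure D).IsTriangulated where
  exists_zero := by
    refine ⟨_, isZero_zero C, fun P hP hP' _ => ?_⟩
    exact P.prop_zero
  isStableUnderShiftBy n := ⟨fun X hX P hP hP' h => P.le_shift n _ (hX P hP hP' h)⟩
  ext₂' T hT h₁ h₃ := ⟨T.obj₂, fun P hP hP' h =>
    P.ext_of_isTriangulatedClosed₂ T hT (h₁ P hP hP' h) (h₃ P hP hP' h), ⟨Iso.refl _⟩⟩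

end Generation

/-! ## Weight structures -/

/-- A weight structure `w` on a triangulated category `C` (homological convention). -/
@[ext]
structure WeightStructure (C : Type*) [Category* C] [Preadditive C] [HasZeroObject C]
    [HasShift C ℤ] [∀ n : ℤ, (shiftFunctor C n).Additive] [Pretriangulated C] where
  /-- the class `C_{w ≤ 0}` -/
  le : ObjectProperty C
  /-- the class `C_{w ≥ 0}` -/
  ge : ObjectProperty C
  le_of_retract : ∀ ⦃X Y : C⦄, Retract X Y → le Y → le X
  ge_of_retract : ∀ ⦃X Y : C⦄, Retract X Y → ge Y → ge X
  /-- `C_{w ≤ 0} ⊆ C_{w ≤ 0}[1]` -/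
  le_shift : ∀ ⦃X : C⦄, le X → le (X⟦(-1 : ℤ)⟧)
  /-- `C_{w ≥ 0}[1] ⊆ C_{w ≥ 0}` -/
  ge_shift : ∀ ⦃X : C⦄, ge X → ge (X⟦(1 : ℤ)⟧)
  /-- there are no non-zero morphisms from `C_{w ≤ 0}` to `C_{w ≥ 0}[1]` -/
  orthogonal : ∀ ⦃X Y : C⦄, le X → ge Y → ∀ f : X ⟶ Y⟦(1 : ℤ)⟧, f = 0
  /-- every object has a weight decomposition -/
  exists_decomposition : ∀ M : C, ∃ (X Y : C) (f : X ⟶ M) (g : M ⟶ Y⟦(1 : ℤ)⟧)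
    (h : Y⟦(1 : ℤ)⟧ ⟶ X⟦(1 : ℤ)⟧), le X ∧ ge Y ∧ Triangle.mk f g h ∈ distTriang C

namespace WeightStructure

section Basic

variable {C : Type*} [Category* C] [Preadditive C] [HasZeroObject C] [HasShift C ℤ]
  [∀ n : ℤ, (shiftFunctor C n).Additive] [Pretriangulated C] (w : WeightStructure C)

/-- The class `C_{w = 0}` of objects of the heart. -/
def heart : ObjectProperty C := w.le ⊓ w.ge

/-- The heart of `w`, as a full subcategory. -/
abbrev Heart := w.heart.FullSubcategory

/-- The class `C_{w ≤ i} = C_{w ≤ 0}[i]`. -/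
def leAt (i : ℤ) : ObjectProperty C := fun M => w.le (M⟦-i⟧)

/-- The class `C_{w ≥ i} = C_{w ≥ 0}[i]`. -/
def geAt (i : ℤ) : ObjectProperty C := fun M => w.ge (M⟦-i⟧)

/-- The objects of `C⁻`: the `w`-bounded above objects. -/
def minus : ObjectProperty C := fun M => ∃ i : ℤ, w.leAt i M

/-- The objects of `C⁺`: the `w`-bounded below objects. -/
def plus : ObjectProperty C := fun M => ∃ i : ℤ, w.geAt i M

/-- `w` is bounded above. -/
def IsBoundedAbove : Prop := ∀ M : C, w.minus M

/-- `w` is bounded below. -/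
def IsBoundedBelow : Prop := ∀ M : C, w.plus M

/-- `(C, w)` is weight-Karoubian: the heart of `w` is idempotent complete. -/
def IsWeightKaroubian : Prop := IsIdempotentComplete w.Heart

end Basic

section Functor

variable {C : Type*} [Category* C] [Preadditive C] [HasZeroObject C] [HasShift C ℤ]
  [∀ n : ℤ, (shiftFunctor C n).Additive] [Pretriangulated C]
  {D : Type*} [Category* D] [Preadditive D] [HasZeroObject D] [HasShift D ℤ]
  [∀ n : ℤ, (shiftFunctor D n).Additive] [Pretriangulated D]

/-- The condition for an exact functor `F : C ⥤ D` to be weight-exact with respect to `w`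
and `w'`. If `F` is the embedding of `C` into an idempotent extension, this says that `w'` is an
extension of `w`. -/
def WeightExact (F : C ⥤ D) (w : WeightStructure C) (w' : WeightStructure D) : Prop :=
  (∀ X : C, w.le X → w'.le (F.obj X)) ∧ (∀ X : C, w.ge X → w'.ge (F.obj X))

end Functor

end WeightStructure

/-! ## Idempotent extensions -/

section Extension

variable {C : Type*} [Category* C] [Preadditive C] [HasZeroObject C] [HasShift C ℤ]
  [∀ n : ℤ, (shiftFunctor C n).Additive] [Pretriangulated C]
  {D : Type*} [Category* D] [Preadditive D] [HasZeroObject D] [HasShift D ℤ]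
  [∀ n : ℤ, (shiftFunctor D n).Additive] [Pretriangulated D]

/-- The embedding `j : C ⥤ D` makes `D` an idempotent extension of `C`: `j` is fully faithful and
exact, and there is a fully faithful exact functor `D ⥤ Karoubi C` which restricts to the
canonical embedding of `C` into `Karoubi C`. -/
structure IsIdempotentExtension (j : C ⥤ D) [j.CommShift ℤ] : Prop where
  full : j.Full
  faithful : j.Faithful
  exact : j.IsTriangulated
  exists_embedding : ∃ (G : D ⥤ Karoubi C) (_ : G.CommShift ℤ),
    G.Full ∧ G.Faithful ∧ G.IsTriangulated ∧ Nonempty (j ⋙ G ≅ toKaroubi C)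

/-- For a class `P` of objects of `C`, the objects `(X, p)` of `Karoubi C` with `X` in `P`. These
are the objects of the idempotent completion of the full subcategory `P`, viewed
inside `Karoubi C`. -/
def karoubiObjects (P : ObjectProperty C) : ObjectProperty (Karoubi C) := fun X => P X.X

end Extension

namespace WeightStructure

variable {C : Type*} [Category* C] [Preadditive C] [HasZeroObject C] [HasShift C ℤ]
  [∀ n : ℤ, (shiftFunctor C n).Additive] [Pretriangulated C] (w : WeightStructure C)

/-- The objects of `Kar^w_min(C)`: the strict full triangulated subcategory of `Karoubi C` strongly
generated by the objects of `C` and of the idempotent completion of the heart of `w`. -/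
def karMin : ObjectProperty (Karoubi C) :=
  strongClosure ((toKaroubi C).essImage ⊔ karoubiObjects w.heart)

/-- The objects of `Kar^w_max(C)`: the strict full triangulated subcategory of `Karoubi C` strongly
generated by the objects of the idempotent completions of `C⁻` and of `C⁺`. -/
def karMax : ObjectProperty (Karoubi C) :=
  strongClosure (karoubiObjects w.minus ⊔ karoubiObjects w.plus)

instance : w.karMin.IsTriangulated := inferInstanceAs (strongClosure _).IsTriangulated

instance : w.karMax.IsTriangulated := inferInstanceAs (strongClosure _).IsTriangulated

instance : w.karMin.IsClosedUnderIsomorphisms :=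
  inferInstanceAs (strongClosure _).IsClosedUnderIsomorphisms

instance : w.karMax.IsClosedUnderIsomorphisms :=
  inferInstanceAs (strongClosure _).IsClosedUnderIsomorphisms

/-- The triangulated category `Kar^w_min(C)`. -/
abbrev KarMin := w.karMin.FullSubcategory

/-- The triangulated category `Kar^w_max(C)`. -/
abbrev KarMax := w.karMax.FullSubcategory

lemma karMin_toKaroubi (X : C) : w.karMin ((toKaroubi C).obj X) :=
  le_strongClosure _ _ (Or.inl ((toKaroubi C).obj_mem_essImage X))

lemma karMax_toKaroubi (M : C) : w.karMax ((toKaroubi C).obj M) := by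
  obtain ⟨X, Y, f, g, h, hX, hY, hT⟩ := w.exists_decomposition M
  refine w.karMax.ext_of_isTriangulatedClosed₂ _ ((toKaroubi C).map_distinguished _ hT) ?_ ?_
  · refine le_strongClosure _ _ (Or.inl ⟨0, ?_⟩)
    exact w.le_of_retract (Retract.ofIso ((shiftFunctorZero' C (-0 : ℤ) neg_zero).app X)) hX
  · refine le_strongClosure _ _ (Or.inr ⟨1, ?_⟩)
    exact w.ge_of_retract
      (Retract.ofIso ((shiftFunctorCompIsoId C (1 : ℤ) (-1) (by simp)).app Y)) hY

/-- The embedding of `C` into `Kar^w_min(C)`. -/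
abbrev toKarMin : C ⥤ w.KarMin := w.karMin.lift (toKaroubi C) w.karMin_toKaroubi

/-- The embedding of `C` into `Kar^w_max(C)`. -/
abbrev toKarMax : C ⥤ w.KarMax := w.karMax.lift (toKaroubi C) w.karMax_toKaroubi

end WeightStructure

set_option linter.unusedSectionVars false

/-! ## Retracts -/

namespace CategoryTheory.Retract

variable {K : Type*} [Category* K]

/-! Every object `M` of an idempotent extension is a retract of some `j.obj X`, and weight
decompositions of `X` are available in `C`. If nothing nonzero maps from `M` to the positive objects
of `C`, the inclusion of `M` in `j.obj X` factors through the image of the nonpositive part of `X`,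
so `M` is a retract of that image (`retractClosure_map_le_of_hom_eq_zero`; the dual is
`retractClosure_map_geAt_of_hom_eq_zero`). Hence both classes of an extension of `w` are forced to
be retraction-closures. This gives uniqueness; one more decomposition gives the heart.

Existence therefore means that every object is `decomposable` with respect to these closures.
Orthogonality allows the two classes to be exchanged in an iterated extension, so decomposable
objects are closed under extensions, and it suffices to decompose all shifts of a set of generators.
The essential case is a retract `M` of an object bounded on one side. Here `M ⊞ M⟦n⟧` comes from `C`
for every odd `n > 0` (`prop_biprod_shift_odd`), hence is decomposable. For large `n` boundedness
makes a component of the decomposition vanish, and the triangle can be cut down to one summand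
(`decomposable_of_retract_of_plus`, `decomposable_of_retract_of_minus`). Conversely, the
decompositions of an extension exhibit the required generators.

`KarMin` and `KarMax` are generated by retracts of this kind, so `w` extends to both. The
decompositions in an extension place it inside `KarMax`. In a weight-Karoubian extension the
idempotents of the heart of `w` split, so its image in `Karoubi C` contains the generators of
`KarMin`. Weight-exactness of the comparison functors is automatic from the retract description
(`WeightExact.of_comp_iso`). -/

/-- Two retracts of the same object which induce the same idempotent are isomorphic. -/
def isoOfEq {X Y Z : K} (h : Retract X Z) (h' : Retract Y Z) (e : h.r ≫ h.i = h'.r ≫ h'.i) :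
    X ≅ Y where
  hom := h.i ≫ h'.r
  inv := h'.i ≫ h.r
  hom_inv_id := by
    have := h.i ≫= e =≫ h.r
    simp only [Category.assoc, h.retract, Category.comp_id] at this
    simp [← this]
  inv_hom_id := by
    have := h'.i ≫= e =≫ h'.r
    simp only [Category.assoc, h'.retract, Category.comp_id] at this
    simp [this]

/-- A fully faithful functor reflects retracts. -/
noncomputable def preimage {K' : Type*} [Category* K'] (F : K ⥤ K') [F.Full] [F.Faithful] {X Y : K}
    (h : Retract (F.obj X) (F.obj Y)) : Retract X Y where
  i := F.preimage h.i
  r := F.preimage h.r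
  retract := F.map_injective (by simp [h.retract])

end CategoryTheory.Retract

/-! ## Extensions of orthogonal classes of objects -/

section Extensions

open ObjectProperty Triangulated

variable {D : Type*} [Category* D] [Preadditive D] [HasZeroObject D] [HasShift D ℤ]
  [∀ n : ℤ, (shiftFunctor D n).Additive] [Pretriangulated D]

/-- A triangle through `Z` restricts to a summand of `Z` containing the image of the first
morphism. -/
lemma exists_triangle_of_retract_of_mor₁ {X Z Y M : D} {f : X ⟶ Z} {g : Z ⟶ Y} {h : Y ⟶ X⟦(1 : ℤ)⟧}
    (hT : Triangle.mk f g h ∈ distTriang D) (ρ : Retract M Z) (hf : f ≫ ρ.r ≫ ρ.i = f) :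
    ∃ (K : D) (g' : M ⟶ K) (h' : K ⟶ X⟦(1 : ℤ)⟧),
      Triangle.mk (f ≫ ρ.r) g' h' ∈ distTriang D ∧ Nonempty (Retract K Y) := by
  obtain ⟨K, g', h', hT'⟩ := distinguished_cocone_triangle (f ≫ ρ.r)
  refine ⟨K, g', h', hT', ?_⟩
  obtain ⟨a, ha₂, ha₃⟩ : ∃ a : K ⟶ Y, g' ≫ a = ρ.i ≫ g ∧ h' ≫ (𝟙 X)⟦(1 : ℤ)⟧' = a ≫ h :=
    complete_distinguished_triangle_morphism _ _ hT' hT (𝟙 X) ρ.i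
      (show (f ≫ ρ.r) ≫ ρ.i = 𝟙 X ≫ f by rw [Category.assoc, hf, Category.id_comp])
  obtain ⟨b, hb₂, hb₃⟩ : ∃ b : Y ⟶ K, g ≫ b = ρ.r ≫ g' ∧ h ≫ (𝟙 X)⟦(1 : ℤ)⟧' = b ≫ h' :=
    complete_distinguished_triangle_morphism _ _ hT hT' (𝟙 X) ρ.r (Category.id_comp _).symm
  rw [CategoryTheory.Functor.map_id, Category.comp_id] at ha₃ hb₃
  -- The composite `a ≫ b` need not be the identity, but it is the third component of an
  -- endomorphism of the triangle whose other components are identities. It is thus invertible, and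
  -- correcting `b` by its inverse gives a retraction.
  let φ : Triangle.mk (f ≫ ρ.r) g' h' ⟶ Triangle.mk (f ≫ ρ.r) g' h' :=
    Triangle.homMk _ _ (𝟙 X) (𝟙 M) (a ≫ b)
      ((Category.comp_id _).trans (Category.id_comp _).symm)
      (show g' ≫ a ≫ b = 𝟙 M ≫ g' by
        rw [reassoc_of% ha₂, hb₂, ρ.retract_assoc, Category.id_comp])
      (show h' ≫ (𝟙 X)⟦1⟧' = (a ≫ b) ≫ h' by
        rw [Category.assoc, ← hb₃, ← ha₃, CategoryTheory.Functor.map_id, Category.comp_id])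
  have : IsIso (a ≫ b) := isIso₃_of_isIso₁₂ φ hT' hT' (IsIso.id _) (IsIso.id _)
  exact ⟨⟨a, b ≫ inv (a ≫ b), by rw [← Category.assoc, IsIso.hom_inv_id]⟩⟩

/-- A triangle through `Z` restricts to a summand of `Z` through which the second morphism
factors. -/
lemma exists_triangle_of_retract_of_mor₂ {X Z Y M : D} {f : X ⟶ Z} {g : Z ⟶ Y} {h : Y ⟶ X⟦(1 : ℤ)⟧}
    (hT : Triangle.mk f g h ∈ distTriang D) (ρ : Retract M Z) (hg : ρ.r ≫ ρ.i ≫ g = g) :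
    ∃ (K : D) (f' : K ⟶ M) (h' : Y ⟶ K⟦(1 : ℤ)⟧),
      Triangle.mk f' (ρ.i ≫ g) h' ∈ distTriang D ∧ Nonempty (Retract K X) := by
  obtain ⟨K, f', h', hT'⟩ := distinguished_cocone_triangle₁ (ρ.i ≫ g)
  refine ⟨K, f', h', hT', ?_⟩
  obtain ⟨a, ha₁, ha₃⟩ : ∃ a : K ⟶ X, f' ≫ ρ.i = a ≫ f ∧ h' ≫ a⟦(1 : ℤ)⟧' = 𝟙 Y ≫ h :=
    complete_distinguished_triangle_morphism₁ _ _ hT' hT ρ.i (𝟙 Y) (Category.comp_id _)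
  obtain ⟨b, hb₁, hb₃⟩ : ∃ b : X ⟶ K, f ≫ ρ.r = b ≫ f' ∧ h ≫ b⟦(1 : ℤ)⟧' = 𝟙 Y ≫ h' :=
    complete_distinguished_triangle_morphism₁ _ _ hT hT' ρ.r (𝟙 Y)
      ((Category.comp_id _).trans hg.symm)
  rw [Category.id_comp] at ha₃ hb₃
  let φ : Triangle.mk f' (ρ.i ≫ g) h' ⟶ Triangle.mk f' (ρ.i ≫ g) h' :=
    Triangle.homMk _ _ (a ≫ b) (𝟙 M) (𝟙 Y)
      (show f' ≫ 𝟙 M = (a ≫ b) ≫ f' by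
        rw [Category.assoc, ← hb₁, ← reassoc_of% ha₁, ρ.retract])
      ((Category.comp_id _).trans (Category.id_comp _).symm)
      (show h' ≫ (a ≫ b)⟦1⟧' = 𝟙 Y ≫ h' by
        rw [Functor.map_comp, reassoc_of% ha₃, hb₃, Category.id_comp])
  have : IsIso (a ≫ b) := isIso₁_of_isIso₂₃ φ hT' hT' (IsIso.id _) (IsIso.id _)
  exact ⟨⟨a, b ≫ inv (a ≫ b), by rw [← Category.assoc, IsIso.hom_inv_id]⟩⟩

variable {L R : ObjectProperty D}

/-- The connecting morphism goes from `L` to a shift of an object of `R`, so it vanishes; the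
extension splits and its summands can be exchanged. -/
lemma extensionProduct_le_extensionProduct_of_orthogonal
    (hR : ∀ X, R X → R (X⟦(1 : ℤ)⟧)) (h : ∀ X Y, L X → R Y → ∀ f : X ⟶ Y, f = 0) :
    extensionProduct R L ≤ extensionProduct L R := by
  rintro Z ⟨Y, X, f, g, k, hT, hY, hX⟩
  obtain ⟨e, -⟩ := exists_iso_binaryBiproduct_of_distTriang _ hT (h _ _ hX (hR _ hY) k)
  exact prop_of_iso _ ((biprod.braiding _ _) ≪≫ e.symm)
    ⟨_, _, _, _, _, binaryBiproductTriangle_distinguished X Y, hX, hY⟩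

/-- Writing `*` for the associative product of classes, `(L * R) * (L * R) = L * (R * L) * R ≤ L *
(L * R) * R = (L * L) * (R * R) ≤ L * R`. Associativity is where the octahedral axiom enters. -/
lemma isTriangulatedClosed₂_extensionProduct_of_orthogonal [IsTriangulated D]
    [L.IsTriangulatedClosed₂] [L.IsClosedUnderIsomorphisms] [R.IsTriangulatedClosed₂]
    [R.IsClosedUnderIsomorphisms]
    (hR : ∀ X, R X → R (X⟦(1 : ℤ)⟧)) (h : ∀ X Y, L X → R Y → ∀ f : X ⟶ Y, f = 0) :
    (extensionProduct L R).IsTriangulatedClosed₂ := by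
  refine .mk' fun T hT h₁ h₃ => ?_
  have key : extensionProduct (extensionProduct L R) (extensionProduct L R) ≤
      extensionProduct L R :=
    calc
      _ = extensionProduct L (extensionProduct (extensionProduct R L) R) := by
        simp only [extensionProduct_assoc]
      _ ≤ extensionProduct L (extensionProduct (extensionProduct L R) R) :=
        monotone_extensionProduct_right _ (monotone_extensionProduct_left _
          (extensionProduct_le_extensionProduct_of_orthogonal hR h))
      _ = extensionProduct (extensionProduct L L) (extensionProduct R R) := by
        simp only [extensionProduct_assoc]
      _ ≤ extensionProduct L (extensionProduct R R) :=
        monotone_extensionProduct_left _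
          (extensionProduct_le_of_isTriangulatedClosed₂ le_rfl le_rfl)
      _ ≤ extensionProduct L R :=
        monotone_extensionProduct_right _
          (extensionProduct_le_of_isTriangulatedClosed₂ le_rfl le_rfl)
  exact key _ ⟨_, _, _, _, _, hT, h₁, h₃⟩

/-- For a class `P` closed under extensions, the objects all of whose shifts are in `P` form a
triangulated subcategory. -/
lemma isTriangulated_forall_shift (P : ObjectProperty D) [P.IsTriangulatedClosed₂]
    [P.IsClosedUnderIsomorphisms] [P.ContainsZero] :
    ObjectProperty.IsTriangulated (fun M => ∀ n : ℤ, P (M⟦n⟧)) :=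
  have : ObjectProperty.IsClosedUnderIsomorphisms (fun M => ∀ n : ℤ, P (M⟦n⟧)) :=
    ⟨fun e h n => P.prop_of_iso ((shiftFunctor D n).mapIso e) (h n)⟩
  { exists_zero := ⟨_, isZero_zero D, fun n =>
      P.prop_of_isZero ((shiftFunctor D n).map_isZero (isZero_zero D))⟩
    isStableUnderShiftBy := fun a => ⟨fun M hM n =>
      P.prop_of_iso ((shiftFunctorAdd D a n).app M) (hM (a + n))⟩
    toIsTriangulatedClosed₂ := .mk' fun T hT h₁ h₃ n =>
      P.ext_of_isTriangulatedClosed₂ _ (T.shift_distinguished hT n) (h₁ n) (h₃ n) }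

/-! ### Summands of objects of a triangulated subcategory -/

/-- A reordering of the summands of a biproduct. -/
noncomputable def biprodBiprodSwapIso (W X Y Z : D) : (W ⊞ X) ⊞ (Y ⊞ Z) ≅ (W ⊞ Z) ⊞ (X ⊞ Y) where
  hom := biprod.lift (biprod.lift (biprod.fst ≫ biprod.fst) (biprod.snd ≫ biprod.snd))
    (biprod.lift (biprod.fst ≫ biprod.snd) (biprod.snd ≫ biprod.fst))
  inv := biprod.lift (biprod.lift (biprod.fst ≫ biprod.fst) (biprod.snd ≫ biprod.fst))
    (biprod.lift (biprod.snd ≫ biprod.snd) (biprod.fst ≫ biprod.snd))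

variable (E : ObjectProperty D) [E.IsTriangulated] [E.IsClosedUnderIsomorphisms]

lemma prop_biprod {X Y : D} (hX : E X) (hY : E Y) : E (X ⊞ Y) :=
  E.ext_of_isTriangulatedClosed₂ _ (binaryBiproductTriangle_distinguished X Y) hX hY

lemma prop_of_prop_biprod {X Y : D} (h : E (X ⊞ Y)) (hY : E Y) : E X :=
  E.ext_of_isTriangulatedClosed₁ _ (binaryBiproductTriangle_distinguished X Y) h hY

lemma binaryBiproduct_inr_fst_distinguished (X Y : D) :
    Triangle.mk (biprod.inr : Y ⟶ X ⊞ Y) biprod.fst 0 ∈ distTriang D :=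
  isomorphic_distinguished _ (binaryBiproductTriangle_distinguished Y X) _
    (Triangle.isoMk _ _ (Iso.refl _) (biprod.braiding _ _) (Iso.refl _)
      (show biprod.inr ≫ (biprod.braiding X Y).hom = 𝟙 Y ≫ biprod.inl by ext <;> simp)
      (show biprod.fst ≫ 𝟙 X = (biprod.braiding X Y).hom ≫ biprod.snd by simp)
      (zero_comp.trans comp_zero.symm))

/-- If a full triangulated subcategory contains an object, it contains the sum of any summand with
its shift. -/
lemma prop_biprod_shift_one [IsTriangulated D] {M X : D} (ρ : Retract M X) (hX : E X) :
    E (M ⊞ M⟦(1 : ℤ)⟧) := by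
  obtain ⟨N, g, h, hT⟩ := distinguished_cocone_triangle ρ.i
  -- Since `ρ.i` is a split monomorphism, so is its shift; hence the connecting morphism vanishes
  -- and `N` is a complement of `M` in `X`.
  have h0 : h = 0 := by
    have : h ≫ ρ.i⟦(1 : ℤ)⟧' = 0 := comp_distTriang_mor_zero₃₁ _ hT
    have := this =≫ ρ.r⟦(1 : ℤ)⟧'
    rwa [Category.assoc, ← Functor.map_comp, ρ.retract, CategoryTheory.Functor.map_id,
      Category.comp_id, zero_comp] at this
  obtain ⟨e, -⟩ := exists_iso_binaryBiproduct_of_distTriang _ hT h0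
  replace hX : E (M ⊞ N) := E.prop_of_iso e hX
  -- The cone of the projector onto `N` lies in `E`. Factoring the projector through `N`, the
  -- octahedron presents this cone as an extension of `M` (cone of `biprod.inr`) by `M⟦1⟧` (cone of
  -- `biprod.snd`), split because the third morphism of the triangle on `biprod.inr` is zero.
  obtain ⟨Z, v₁₃, w₁₃, h₁₃⟩ := distinguished_cocone_triangle
    ((biprod.snd : M ⊞ N ⟶ N) ≫ (biprod.inr : N ⟶ M ⊞ N))
  have hZ : E Z := E.ext_of_isTriangulatedClosed₃ _ h₁₃ hX hX
  have O := someOctahedron rfl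
    (rot_of_distTriang _ (binaryBiproductTriangle_distinguished M N))
    (binaryBiproduct_inr_fst_distinguished M N) h₁₃
  obtain ⟨e', -⟩ := exists_iso_binaryBiproduct_of_distTriang _ O.mem
    zero_comp
  exact E.prop_of_iso (e' ≪≫ biprod.braiding _ _) hZ

/-- If a full triangulated subcategory contains an object, it contains the sum of any summand with
each of its odd positive shifts. -/
lemma prop_biprod_shift_odd [IsTriangulated D] {M X : D} (ρ : Retract M X) (hX : E X) (k : ℕ) :
    E (M ⊞ M⟦(2 * k + 1 : ℤ)⟧) := by
  have aux (a b : ℤ) (hb : a + 1 = b) : E (M⟦a⟧ ⊞ M⟦b⟧) := by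
    have e : (M⟦a⟧)⟦(1 : ℤ)⟧ ≅ M⟦b⟧ := (shiftFunctorAdd' D a 1 b hb).symm.app M
    refine E.prop_of_iso (biprod.mapIso (Iso.refl _) e) ?_
    exact prop_biprod_shift_one E (ρ.map (shiftFunctor D a)) (E.le_shift a _ hX)
  induction k with
  | zero =>
    have e : M⟦(0 : ℤ)⟧ ≅ M := (shiftFunctorZero D ℤ).app M
    exact E.prop_of_iso (biprod.mapIso e (Iso.refl _)) (aux 0 _ (by simp))
  | succ k hk =>
    -- Add `M⟦2k+2⟧ ⊞ M⟦2k+3⟧` to `M ⊞ M⟦2k+1⟧`, then cancel `M⟦2k+1⟧ ⊞ M⟦2k+2⟧`.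
    refine prop_of_prop_biprod E (E.prop_of_iso (biprodBiprodSwapIso _ _ _ _)
      (prop_biprod E hk (aux (2 * k + 2) _ ?_))) (aux (2 * k + 1) (2 * k + 2) (by ring))
    push_cast
    ring

end Extensions

/-! ## Weight structures on idempotent extensions -/


namespace WeightStructure

open ObjectProperty Triangulated

variable {C : Type*} [Category* C] [Preadditive C] [HasZeroObject C] [HasShift C ℤ]
  [∀ n : ℤ, (shiftFunctor C n).Additive] [Pretriangulated C] (w : WeightStructure C)

/-! ### Shifts and orthogonality of the weight classes. -/

instance : w.le.IsStableUnderRetracts := ⟨fun h hY => w.le_of_retract h hY⟩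

instance : w.ge.IsStableUnderRetracts := ⟨fun h hY => w.ge_of_retract h hY⟩

instance (i : ℤ) : (w.geAt i).IsStableUnderRetracts :=
  ⟨fun h hY => w.ge_of_retract (h.map (shiftFunctor C (-i))) hY⟩

lemma prop_of_iso_shift {P : ObjectProperty C} [P.IsClosedUnderIsomorphisms] {X : C} {a b c : ℤ}
    (h : a + b = c) : P ((X⟦a⟧)⟦b⟧) ↔ P (X⟦c⟧) :=
  P.prop_iff_of_iso ((shiftFunctorAdd' C a b c h).symm.app X)

lemma le_shift_of_le {X : C} {a b : ℤ} (hX : w.le (X⟦a⟧)) (h : b ≤ a) : w.le (X⟦b⟧) := by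
  obtain ⟨n, rfl⟩ : ∃ n : ℕ, b = a - n := ⟨(a - b).toNat, by omega⟩
  clear h
  induction n with
  | zero => simpa using hX
  | succ n hn => exact (prop_of_iso_shift (by push_cast; ring)).1 (w.le_shift hn)

lemma ge_shift_of_le {X : C} {a b : ℤ} (hX : w.ge (X⟦a⟧)) (h : a ≤ b) : w.ge (X⟦b⟧) := by
  obtain ⟨n, rfl⟩ : ∃ n : ℕ, b = a + n := ⟨(b - a).toNat, by omega⟩
  clear h
  induction n with
  | zero => simpa using hX
  | succ n hn => exact (prop_of_iso_shift (by push_cast; ring)).1 (w.ge_shift hn)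

lemma le_shift_zero {X : C} : w.le (X⟦(0 : ℤ)⟧) ↔ w.le X :=
  w.le.prop_iff_of_iso ((shiftFunctorZero C ℤ).app X)

lemma ge_shift_zero {X : C} : w.ge (X⟦(0 : ℤ)⟧) ↔ w.ge X :=
  w.ge.prop_iff_of_iso ((shiftFunctorZero C ℤ).app X)

lemma geAt_one_shift {Y : C} : w.geAt 1 (Y⟦(1 : ℤ)⟧) ↔ w.ge Y :=
  (prop_of_iso_shift (P := w.ge) (add_neg_cancel 1)).trans w.ge_shift_zero

lemma hom_eq_zero {X Y : C} (hX : w.le X) (hY : w.geAt 1 Y) (f : X ⟶ Y) : f = 0 := by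
  let e : (Y⟦(-1 : ℤ)⟧)⟦(1 : ℤ)⟧ ≅ Y := (shiftFunctorCompIsoId C (-1 : ℤ) 1 (by simp)).app Y
  rw [← cancel_mono e.inv, zero_comp]
  exact w.orthogonal hX hY _

/-- With `geAt 1` in place of shifted objects of `ge`, decompositions and orthogonality concern one
pair of classes, and the extension product applies directly. -/
lemma extensionProduct_le_geAt (M : C) : extensionProduct w.le (w.geAt 1) M := by
  obtain ⟨X, Y, f, g, h, hX, hY, hT⟩ := w.exists_decomposition M
  exact ⟨_, _, _, _, _, hT, hX, w.geAt_one_shift.2 hY⟩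

section

variable {D : Type*} [Category* D] [Preadditive D] [HasZeroObject D] [HasShift D ℤ]
  [∀ n : ℤ, (shiftFunctor D n).Additive] [Pretriangulated D]
  (j : C ⥤ D) [j.CommShift ℤ] [j.IsTriangulated]

/-! ### Retraction-closures detected by orthogonality. -/

lemma retractClosure_map_le_of_hom_eq_zero {M : D} {X : C} (ρ : Retract M (j.obj X))
    (hM : ∀ (Y : C) (_ : w.geAt 1 Y) (f : M ⟶ j.obj Y), f = 0) :
    (w.le.map j).retractClosure M := by
  obtain ⟨A, B, f, g, h, hT, hA, hB⟩ := w.extensionProduct_le_geAt X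
  obtain ⟨a, ha⟩ : ∃ a : M ⟶ j.obj A, ρ.i = a ≫ j.map f :=
    Triangle.coyoneda_exact₂ _ (j.map_distinguished _ hT) ρ.i (hM B hB _)
  exact prop_retractClosure (prop_map_obj _ _ hA) ⟨a, j.map f ≫ ρ.r, by
    rw [← Category.assoc, ← ha, ρ.retract]⟩

lemma retractClosure_map_geAt_of_hom_eq_zero {M : D} {X : C} (ρ : Retract M (j.obj X))
    (hM : ∀ (Y : C) (_ : w.le Y) (f : j.obj Y ⟶ M), f = 0) :
    ((w.geAt 1).map j).retractClosure M := by
  obtain ⟨A, B, f, g, h, hT, hA, hB⟩ := w.extensionProduct_le_geAt X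
  obtain ⟨b, hb⟩ : ∃ b : j.obj B ⟶ M, ρ.r = j.map g ≫ b :=
    Triangle.yoneda_exact₂ _ (j.map_distinguished _ hT) ρ.r (hM A hA _)
  exact prop_retractClosure (prop_map_obj _ _ hB) ⟨ρ.i ≫ j.map g, b, by
    rw [Category.assoc, ← hb, ρ.retract]⟩

lemma retractClosure_map_ge_of_shift {M : D}
    (hM : ((w.geAt 1).map j).retractClosure (M⟦(1 : ℤ)⟧)) : (w.ge.map j).retractClosure M := by
  obtain ⟨N, ⟨Y, hY, ⟨e⟩⟩, ⟨ρ⟩⟩ := hM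
  let e' : M ≅ (M⟦(1 : ℤ)⟧)⟦(-1 : ℤ)⟧ := ((shiftFunctorCompIsoId D (1 : ℤ) (-1) (by simp)).app M).symm
  exact prop_retractClosure (prop_map_obj w.ge j hY)
    ((Retract.ofIso e').trans ((ρ.map (shiftFunctor D (-1 : ℤ))).trans
      (Retract.ofIso ((shiftFunctor D (-1 : ℤ)).mapIso e.symm ≪≫
        ((j.commShiftIso (-1 : ℤ)).app Y).symm))))

lemma retractClosure_map_geAt_shift {M : D}
    (hM : (w.ge.map j).retractClosure M) : ((w.geAt 1).map j).retractClosure (M⟦(1 : ℤ)⟧) := by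
  obtain ⟨N, ⟨Y, hY, ⟨e⟩⟩, ⟨ρ⟩⟩ := hM
  exact prop_retractClosure (prop_map_obj (w.geAt 1) j (w.geAt_one_shift.2 hY))
    ((ρ.map (shiftFunctor D (1 : ℤ))).trans
      (Retract.ofIso ((shiftFunctor D (1 : ℤ)).mapIso e.symm ≪≫
        ((j.commShiftIso (1 : ℤ)).app Y).symm)))

/-- This is the detection lemma for the identity functor, where the retraction-closure adds nothing
to `w.le`. -/
lemma le_iff_hom_eq_zero {X : C} :
    w.le X ↔ ∀ (Y : C) (_ : w.geAt 1 Y) (f : X ⟶ Y), f = 0 := by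
  refine ⟨fun hX Y hY f => w.hom_eq_zero hX hY f, fun h => ?_⟩
  obtain ⟨N, ⟨Y, hY, ⟨e⟩⟩, ⟨ρ⟩⟩ := w.retractClosure_map_le_of_hom_eq_zero (𝟭 C) (Retract.refl X) h
  exact w.le_of_retract (ρ.trans (Retract.ofIso e.symm)) hY

lemma geAt_iff_hom_eq_zero {X : C} :
    w.geAt 1 X ↔ ∀ (Y : C) (_ : w.le Y) (f : Y ⟶ X), f = 0 := by
  refine ⟨fun hX Y hY f => w.hom_eq_zero hY hX f, fun h => ?_⟩
  obtain ⟨N, ⟨Y, hY, ⟨e⟩⟩, ⟨ρ⟩⟩ :=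
    w.retractClosure_map_geAt_of_hom_eq_zero (𝟭 C) (Retract.refl X) h
  exact (w.geAt 1).prop_of_retract (ρ.trans (Retract.ofIso e.symm)) hY

/-! ### Uniqueness of extensions -/

variable {w j} {w' : WeightStructure D}

lemma WeightExact.geAt (hw' : WeightExact j w w') {X : C} {i : ℤ} (hX : w.geAt i X) :
    w'.geAt i (j.obj X) :=
  w'.ge.prop_of_iso ((j.commShiftIso (-i)).app X) (hw'.2 _ hX)

lemma WeightExact.leAt (hw' : WeightExact j w w') {X : C} {i : ℤ} (hX : w.leAt i X) :
    w'.leAt i (j.obj X) :=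
  w'.le.prop_of_iso ((j.commShiftIso (-i)).app X) (hw'.1 _ hX)

lemma WeightExact.le_eq (hw' : WeightExact j w w')
    (hj : ∀ M : D, ∃ X : C, Nonempty (Retract M (j.obj X))) :
    w'.le = (w.le.map j).retractClosure := by
  ext M
  constructor
  · intro hM
    obtain ⟨X, ⟨ρ⟩⟩ := hj M
    exact w.retractClosure_map_le_of_hom_eq_zero j ρ
      fun Y hY f => w'.hom_eq_zero hM (hw'.geAt hY) f
  · rintro ⟨N, ⟨X, hX, ⟨e⟩⟩, ⟨ρ⟩⟩
    exact w'.le_of_retract (ρ.trans (Retract.ofIso e.symm)) (hw'.1 _ hX)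

lemma WeightExact.ge_eq (hw' : WeightExact j w w')
    (hj : ∀ M : D, ∃ X : C, Nonempty (Retract M (j.obj X))) :
    w'.ge = (w.ge.map j).retractClosure := by
  ext M
  constructor
  · intro hM
    obtain ⟨X, ⟨ρ⟩⟩ := hj (M⟦(1 : ℤ)⟧)
    exact w.retractClosure_map_ge_of_shift j (w.retractClosure_map_geAt_of_hom_eq_zero j ρ
      fun Y hY f => w'.hom_eq_zero (hw'.1 _ hY) (w'.geAt_one_shift.2 hM) f)
  · rintro ⟨N, ⟨X, hX, ⟨e⟩⟩, ⟨ρ⟩⟩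
    exact w'.ge_of_retract (ρ.trans (Retract.ofIso e.symm)) (hw'.2 _ hX)

lemma WeightExact.heart_eq (hw' : WeightExact j w w')
    (hj : ∀ M : D, ∃ X : C, Nonempty (Retract M (j.obj X))) :
    w'.heart = (w.heart.map j).retractClosure := by
  ext M
  constructor
  · rintro ⟨hM, hM'⟩
    rw [hw'.le_eq hj] at hM
    obtain ⟨_, ⟨A, hA, ⟨e⟩⟩, ⟨ρ⟩⟩ := hM
    -- Being a retract of an object of `le` and of another of `ge` does not yet give one object of
    -- the heart. Decomposing `A⟦1⟧` and shifting back yields a triangle on `A` whose third term is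
    -- in `ge` and whose first term becomes nonpositive even after a shift by `1`.
    obtain ⟨X, N, f, g, h, hT, hX, hN⟩ := w.extensionProduct_le_geAt (A⟦(1 : ℤ)⟧)
    have hT' := Triangle.shift_distinguished _ hT (-1)
    set T := (CategoryTheory.shiftFunctor (Triangle C) (-1 : ℤ)).obj (Triangle.mk f g h)
    have hX' : w.le (T.obj₁⟦(1 : ℤ)⟧) :=
      (prop_of_iso_shift (P := w.le) (neg_add_cancel 1)).2 (w.le_shift_zero.2 hX)
    have hA' : w.le T.obj₂ :=
      (prop_of_iso_shift (P := w.le) (add_neg_cancel 1)).2 (w.le_shift_zero.2 hA)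
    have hN' : w.le T.obj₃ := by
      -- The third term is an extension of `T.obj₁⟦1⟧` by `T.obj₂`, both in `le`; it therefore lies
      -- in the heart.
      refine w.le_iff_hom_eq_zero.2 fun Y hY k => ?_
      obtain ⟨l, rfl⟩ := T.yoneda_exact₃ hT' k (w.hom_eq_zero hA' hY _)
      rw [w.hom_eq_zero hX' hY l, comp_zero]
    let ρ' : Retract M (j.obj T.obj₂) := ρ.trans (Retract.ofIso (e.symm ≪≫
      j.mapIso ((shiftFunctorCompIsoId C (1 : ℤ) (-1) (by simp)).app A).symm))
    -- After a shift by `1` this is a morphism from `le` to `geAt 1`. The retraction onto `M` then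
    -- factors through the heart object `T.obj₃`.
    have hzero : j.map T.mor₁ ≫ ρ'.r = 0 := by
      apply (CategoryTheory.shiftFunctor D (1 : ℤ)).map_injective
      rw [Functor.map_zero]
      exact w'.hom_eq_zero (w'.le.prop_of_iso ((j.commShiftIso (1 : ℤ)).app _) (hw'.1 _ hX'))
        (w'.geAt_one_shift.2 hM') _
    obtain ⟨b, hb⟩ : ∃ b : j.obj T.obj₃ ⟶ M, ρ'.r = j.map T.mor₂ ≫ b :=
      Triangle.yoneda_exact₂ _ (j.map_distinguished _ hT') ρ'.r hzero
    exact prop_retractClosure (prop_map_obj w.heart j ⟨hN', hN⟩) ⟨ρ'.i ≫ j.map T.mor₂, b, by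
      rw [Category.assoc, ← hb, ρ'.retract]⟩
  · rintro ⟨N, ⟨X, hX, ⟨e⟩⟩, ⟨ρ⟩⟩
    exact ⟨w'.le_of_retract (ρ.trans (Retract.ofIso e.symm)) (hw'.1 _ hX.1),
      w'.ge_of_retract (ρ.trans (Retract.ofIso e.symm)) (hw'.2 _ hX.2)⟩

lemma WeightExact.isBoundedBelow_iff [j.Full] [j.Faithful] (hw' : WeightExact j w w')
    (hj : ∀ M : D, ∃ X : C, Nonempty (Retract M (j.obj X))) :
    w'.IsBoundedBelow ↔ w.IsBoundedBelow := by
  constructor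
  · intro h X
    obtain ⟨i, hi⟩ := h (j.obj X)
    refine ⟨i, ?_⟩
    have hi' : w'.ge (j.obj (X⟦-i⟧)) := w'.ge.prop_of_iso ((j.commShiftIso (-i)).symm.app X) hi
    -- Membership in `ge` is a vanishing condition on morphisms, and a faithful `j` reflects
    -- vanishing.
    refine w.geAt_one_shift.1 (w.geAt_iff_hom_eq_zero.2 fun Y hY f => j.map_injective ?_)
    rw [Functor.map_zero]
    exact w'.hom_eq_zero (hw'.1 _ hY) (w'.ge.prop_of_iso ((j.commShiftIso (-1 : ℤ)).app _)
      (w'.ge.prop_of_iso (j.mapIso ((shiftFunctorCompIsoId C (1 : ℤ) (-1) (by simp)).app _).symm)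
        hi')) _
  · intro h M
    obtain ⟨X, ⟨ρ⟩⟩ := hj M
    obtain ⟨i, hi⟩ := h X
    exact ⟨i, (w'.geAt i).prop_of_retract ρ (hw'.geAt hi)⟩

lemma WeightExact.isBoundedAbove_iff [j.Full] [j.Faithful] (hw' : WeightExact j w w')
    (hj : ∀ M : D, ∃ X : C, Nonempty (Retract M (j.obj X))) :
    w'.IsBoundedAbove ↔ w.IsBoundedAbove := by
  constructor
  · intro h X
    obtain ⟨i, hi⟩ := h (j.obj X)
    refine ⟨i, ?_⟩
    have hi' : w'.le (j.obj (X⟦-i⟧)) := w'.le.prop_of_iso ((j.commShiftIso (-i)).symm.app X) hi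
    refine w.le_iff_hom_eq_zero.2 fun Y hY f => j.map_injective ?_
    rw [Functor.map_zero]
    exact w'.hom_eq_zero hi' (hw'.geAt hY) _
  · intro h M
    obtain ⟨X, ⟨ρ⟩⟩ := hj M
    obtain ⟨i, hi⟩ := h X
    exact ⟨i, w'.le_of_retract (ρ.map (CategoryTheory.shiftFunctor D (-i))) (hw'.leAt hi)⟩

/-! ### Existence of extensions -/

variable (w j)

lemma hom_eq_zero_of_retractClosure [j.Full] {X Y : D} (hX : (w.le.map j).retractClosure X)
    (hY : ((w.geAt 1).map j).retractClosure Y) (f : X ⟶ Y) : f = 0 := by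
  obtain ⟨_, ⟨A, hA, ⟨e⟩⟩, ⟨ρ⟩⟩ := hX
  obtain ⟨_, ⟨B, hB, ⟨e'⟩⟩, ⟨ρ'⟩⟩ := hY
  obtain ⟨k, hk⟩ := j.map_surjective (e.hom ≫ ρ.r ≫ f ≫ ρ'.i ≫ e'.inv)
  rw [w.hom_eq_zero hA hB k, Functor.map_zero] at hk
  have : f = (ρ.i ≫ e.inv) ≫ (e.hom ≫ ρ.r ≫ f ≫ ρ'.i ≫ e'.inv) ≫ e'.hom ≫ ρ'.r := by simp
  rw [this, ← hk, zero_comp, comp_zero]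

/-- The description as an orthogonal is needed because orthogonals are visibly closed under
extensions, whereas retraction-closures are not. -/
lemma retractClosure_map_le_eq_leftOrthogonal [j.Full]
    (hj : ∀ M : D, ∃ X : C, Nonempty (Retract M (j.obj X))) :
    (w.le.map j).retractClosure = ((w.geAt 1).map j).retractClosure.leftOrthogonal := by
  ext M
  refine ⟨fun hM Y f hY => w.hom_eq_zero_of_retractClosure j hM hY f, fun hM => ?_⟩
  obtain ⟨X, ⟨ρ⟩⟩ := hj M
  exact w.retractClosure_map_le_of_hom_eq_zero j ρ
    fun Y hY f => hM f (le_retractClosure _ _ (prop_map_obj _ _ hY))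

lemma retractClosure_map_geAt_eq_rightOrthogonal [j.Full]
    (hj : ∀ M : D, ∃ X : C, Nonempty (Retract M (j.obj X))) :
    ((w.geAt 1).map j).retractClosure = (w.le.map j).retractClosure.rightOrthogonal := by
  ext M
  refine ⟨fun hM Y f hY => w.hom_eq_zero_of_retractClosure j hY hM f, fun hM => ?_⟩
  obtain ⟨X, ⟨ρ⟩⟩ := hj M
  exact w.retractClosure_map_geAt_of_hom_eq_zero j ρ
    fun Y hY f => hM f (le_retractClosure _ _ (prop_map_obj _ _ hY))

/-- The objects of `D` admitting a decomposition with respect to the retraction-closures of the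
classes of a weight structure `w` on `C`. -/
abbrev decomposable : ObjectProperty D :=
  extensionProduct (w.le.map j).retractClosure ((w.geAt 1).map j).retractClosure

lemma decomposable_obj (X : C) : w.decomposable j (j.obj X) := by
  obtain ⟨A, B, f, g, h, hT, hA, hB⟩ := w.extensionProduct_le_geAt X
  exact ⟨_, _, _, _, _, j.map_distinguished _ hT, le_retractClosure _ _ (prop_map_obj _ _ hA),
    le_retractClosure _ _ (prop_map_obj _ _ hB)⟩

instance : (w.decomposable j).ContainsZero :=
  ⟨_, j.map_isZero (isZero_zero C), w.decomposable_obj j _⟩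

lemma retractClosure_map_geAt_shift_one {M : D} (hM : ((w.geAt 1).map j).retractClosure M) :
    ((w.geAt 1).map j).retractClosure (M⟦(1 : ℤ)⟧) := by
  refine w.retractClosure_map_geAt_shift j (monotone_retractClosure (map_monotone ?_ j) _ hM)
  intro X hX
  exact w.ge_shift_zero.1 (w.ge_shift_of_le (hX : w.ge (X⟦(-1 : ℤ)⟧)) (by simp))

lemma isTriangulatedClosed₂_decomposable [j.Full] [IsTriangulated D]
    (hj : ∀ M : D, ∃ X : C, Nonempty (Retract M (j.obj X))) :
    (w.decomposable j).IsTriangulatedClosed₂ := by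
  have : (w.le.map j).retractClosure.IsTriangulatedClosed₂ := by
    rw [w.retractClosure_map_le_eq_leftOrthogonal j hj]
    infer_instance
  have : ((w.geAt 1).map j).retractClosure.IsTriangulatedClosed₂ := by
    rw [w.retractClosure_map_geAt_eq_rightOrthogonal j hj]
    infer_instance
  exact isTriangulatedClosed₂_extensionProduct_of_orthogonal
    (fun M hM => w.retractClosure_map_geAt_shift_one j hM)
    (fun _ _ hX hY f => w.hom_eq_zero_of_retractClosure j hX hY f)

/-- The essential image of the full exact functor `j` is a triangulated subcategory, so it contains
this sum even when `M` itself is not in it. -/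
lemma decomposable_biprod_shift_odd [j.Full] [IsTriangulated D] {M : D} {X : C}
    (ρ : Retract M (j.obj X)) (k : ℕ) : w.decomposable j (M ⊞ M⟦(2 * k + 1 : ℤ)⟧) := by
  obtain ⟨Y, ⟨e⟩⟩ := prop_biprod_shift_odd j.essImage ρ (j.obj_mem_essImage X) k
  exact prop_of_iso _ e (w.decomposable_obj j Y)

/-- For large `n` the summand `M⟦n⟧` is positive, so the nonpositive part of a decomposition of `M ⊞
M⟦n⟧` maps only to `M`. Cutting the triangle down to `M` replaces its positive part by a retract. -/
lemma decomposable_of_retract_of_plus [j.Full] [IsTriangulated D] {M : D} {X : C}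
    (ρ : Retract M (j.obj X)) (hX : w.plus X) : w.decomposable j M := by
  obtain ⟨i, hi⟩ := hX
  -- This `n` is odd, as the summand trick demands, and satisfies `-i ≤ n - 1`, which puts `X⟦n⟧` in
  -- `geAt 1`.
  obtain ⟨n, hn⟩ : ∃ n : ℤ, n = 2 * (i.natAbs : ℤ) + 1 := ⟨_, rfl⟩
  have hdec := w.decomposable_biprod_shift_odd j ρ i.natAbs
  rw [← hn] at hdec
  obtain ⟨A, B, f, g, h, hT, hA, hB⟩ := hdec
  have hM : ((w.geAt 1).map j).retractClosure (M⟦n⟧) := by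
    refine prop_retractClosure (prop_map_obj (w.geAt 1) j (X := X⟦n⟧) ?_)
      ((ρ.map (CategoryTheory.shiftFunctor D n)).trans
        (Retract.ofIso ((j.commShiftIso n).symm.app X)))
    exact (prop_of_iso_shift (P := w.ge) rfl).2 (w.ge_shift_of_le hi (by omega))
  have hf : f ≫ biprod.snd = 0 := w.hom_eq_zero_of_retractClosure j hA hM _
  obtain ⟨K, g', h', hT', ⟨ρ'⟩⟩ := exists_triangle_of_retract_of_mor₁ hT
    (⟨biprod.inl, biprod.fst, biprod.inl_fst⟩ : Retract M (M ⊞ M⟦n⟧)) (by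
      ext
      · simp
      · simp [hf])
  exact ⟨_, _, _, _, _, hT', hA, prop_of_retract _ ρ' hB⟩

lemma decomposable_of_retract_of_minus [j.Full] [IsTriangulated D] {M : D} {X : C}
    (ρ : Retract M (j.obj X)) (hX : w.minus X) : w.decomposable j M := by
  obtain ⟨i, hi⟩ := hX
  obtain ⟨n, hn⟩ : ∃ n : ℤ, n = 2 * (i.natAbs : ℤ) + 1 := ⟨_, rfl⟩
  -- Dually, the unwanted summand must be the nonpositive one. Starting from `M⟦-n⟧` makes `M` the
  -- higher summand, the one that is kept.
  obtain ⟨M', hM'⟩ : ∃ M' : D, M' = M⟦-n⟧ := ⟨_, rfl⟩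
  have ρ₁ : Retract M' (j.obj (X⟦-n⟧)) := hM' ▸ (ρ.map (CategoryTheory.shiftFunctor D (-n))).trans
    (Retract.ofIso ((j.commShiftIso (-n)).symm.app X))
  have hdec := w.decomposable_biprod_shift_odd j ρ₁ i.natAbs
  rw [← hn] at hdec
  obtain ⟨A, B, f, g, h, hT, hA, hB⟩ := hdec
  have hM : (w.le.map j).retractClosure M' :=
    prop_retractClosure (prop_map_obj w.le j (w.le_shift_of_le hi (by omega))) ρ₁
  have hg : biprod.inl ≫ g = 0 := w.hom_eq_zero_of_retractClosure j hM hB _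
  obtain ⟨K, f', h', hT', ⟨ρ'⟩⟩ := exists_triangle_of_retract_of_mor₂ hT
    (⟨biprod.inr, biprod.snd, biprod.inr_snd⟩ : Retract (M'⟦n⟧) (M' ⊞ M'⟦n⟧)) (by
      ext
      · simp [hg]
      · simp)
  subst hM'
  exact prop_of_iso _ ((shiftFunctorCompIsoId D (-n) n (by simp)).app M)
    ⟨_, _, _, _, _, hT', prop_of_retract _ ρ' hA, hB⟩

/-- The weight structure on `D` given by the retraction-closures of the classes of a weight
structure on `C`, provided that decompositions exist. -/
def retractExtension [j.Full] (h : ∀ M : D, w.decomposable j M) : WeightStructure D where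
  le := (w.le.map j).retractClosure
  ge := (w.ge.map j).retractClosure
  le_of_retract _ _ ρ hY := prop_of_retract _ ρ hY
  ge_of_retract _ _ ρ hY := prop_of_retract _ ρ hY
  le_shift := by
    rintro X ⟨_, ⟨Y, hY, ⟨e⟩⟩, ⟨ρ⟩⟩
    exact prop_retractClosure (prop_map_obj w.le j (w.le_shift hY))
      ((ρ.map (CategoryTheory.shiftFunctor D (-1 : ℤ))).trans
        (Retract.ofIso ((CategoryTheory.shiftFunctor D (-1 : ℤ)).mapIso e.symm ≪≫
          ((j.commShiftIso (-1 : ℤ)).app Y).symm)))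
  ge_shift := by
    rintro X ⟨_, ⟨Y, hY, ⟨e⟩⟩, ⟨ρ⟩⟩
    exact prop_retractClosure (prop_map_obj w.ge j (w.ge_shift hY))
      ((ρ.map (CategoryTheory.shiftFunctor D (1 : ℤ))).trans
        (Retract.ofIso ((CategoryTheory.shiftFunctor D (1 : ℤ)).mapIso e.symm ≪≫
          ((j.commShiftIso (1 : ℤ)).app Y).symm)))
  orthogonal X Y hX hY f :=
    w.hom_eq_zero_of_retractClosure j hX (w.retractClosure_map_geAt_shift j hY) f
  exists_decomposition M := by
    obtain ⟨A, B, f, g, k, hT, hA, hB⟩ := h M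
    let e : (B⟦(-1 : ℤ)⟧)⟦(1 : ℤ)⟧ ≅ B := (shiftFunctorCompIsoId D (-1 : ℤ) 1 (by simp)).app B
    refine ⟨A, B⟦(-1 : ℤ)⟧, f, g ≫ e.inv, e.hom ≫ k, hA,
      w.retractClosure_map_ge_of_shift j (prop_of_iso _ e.symm hB),
      isomorphic_distinguished _ hT _ (Triangle.isoMk _ _ (Iso.refl _) (Iso.refl _) e ?_ ?_ ?_)⟩
    · exact (Category.comp_id _).trans (Category.id_comp _).symm
    · change (g ≫ e.inv) ≫ e.hom = 𝟙 M ≫ g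
      simp
    · change (e.hom ≫ k) ≫ (𝟙 A)⟦(1 : ℤ)⟧' = e.hom ≫ k
      simp

lemma weightExact_retractExtension [j.Full] (h : ∀ M : D, w.decomposable j M) :
    WeightExact j w (w.retractExtension j h) :=
  ⟨fun _ hX => le_retractClosure _ _ (prop_map_obj _ _ hX),
    fun _ hX => le_retractClosure _ _ (prop_map_obj _ _ hX)⟩

theorem exists_extension_of_strongClosure_eq_top [j.Full] [IsTriangulated D]
    (hj : ∀ M : D, ∃ X : C, Nonempty (Retract M (j.obj X))) {C₁ C₂ : ObjectProperty D}
    (h₁ : C₁ ≤ (w.plus.map j).retractClosure) (h₂ : C₂ ≤ (w.minus.map j).retractClosure)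
    (h : strongClosure (j.essImage ⊔ C₁ ⊔ C₂) = ⊤) :
    ∃ w' : WeightStructure D, WeightExact j w w' := by
  have := w.isTriangulatedClosed₂_decomposable j hj
  have hP := isTriangulated_forall_shift (w.decomposable j)
  have hP' : ObjectProperty.IsClosedUnderIsomorphisms
      (fun M : D => ∀ n : ℤ, w.decomposable j (M⟦n⟧)) :=
    ⟨fun e h n => prop_of_iso _ ((CategoryTheory.shiftFunctor D n).mapIso e) (h n)⟩
  have key (M : D) : w.decomposable j M := by
    have hM : strongClosure (j.essImage ⊔ C₁ ⊔ C₂) M := by rw [h]; trivial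
    -- Decomposability is not evidently stable under shifts, so the generation argument runs with
    -- all shifts at once and is read off at shift `0`.
    refine prop_of_iso _ ((shiftFunctorZero D ℤ).app M) (hM _ hP hP' ?_ 0)
    rintro N ((⟨X, ⟨e⟩⟩ | hN) | hN) n
    · exact prop_of_iso _ ((j.commShiftIso n).app X ≪≫
        (CategoryTheory.shiftFunctor D n).mapIso e) (w.decomposable_obj j _)
    · obtain ⟨_, ⟨X, ⟨i, hX⟩, ⟨e⟩⟩, ⟨ρ⟩⟩ := h₁ _ hN
      refine w.decomposable_of_retract_of_plus j (X := X⟦n⟧)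
        (((ρ.trans (Retract.ofIso e.symm)).map (CategoryTheory.shiftFunctor D n)).trans
          (Retract.ofIso ((j.commShiftIso n).symm.app X))) ⟨i + n, ?_⟩
      exact (prop_of_iso_shift (P := w.ge) (by ring)).2 hX
    · obtain ⟨_, ⟨X, ⟨i, hX⟩, ⟨e⟩⟩, ⟨ρ⟩⟩ := h₂ _ hN
      refine w.decomposable_of_retract_of_minus j (X := X⟦n⟧)
        (((ρ.trans (Retract.ofIso e.symm)).map (CategoryTheory.shiftFunctor D n)).trans
          (Retract.ofIso ((j.commShiftIso n).symm.app X))) ⟨i + n, ?_⟩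
      exact (prop_of_iso_shift (P := w.le) (by ring)).2 hX
  exact ⟨_, w.weightExact_retractExtension j key⟩

theorem exists_extension_of_isBounded [j.Full] [IsTriangulated D]
    (hj : ∀ M : D, ∃ X : C, Nonempty (Retract M (j.obj X)))
    (h : w.IsBoundedBelow ∨ w.IsBoundedAbove) : ∃ w' : WeightStructure D, WeightExact j w w' := by
  refine w.exists_extension_of_strongClosure_eq_top j hj le_rfl le_rfl (top_le_iff.1 ?_)
  refine le_trans (fun M _ => ?_) (le_strongClosure _)
  obtain ⟨X, ⟨ρ⟩⟩ := hj M
  rcases h with h | h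
  · exact Or.inl (Or.inr (prop_retractClosure (prop_map_obj _ _ (h X)) ρ))
  · exact Or.inr (prop_retractClosure (prop_map_obj _ _ (h X)) ρ)

variable {w j} in
lemma WeightExact.strongClosure_eq_top (hw' : WeightExact j w w')
    (hj : ∀ M : D, ∃ X : C, Nonempty (Retract M (j.obj X))) :
    strongClosure (j.essImage ⊔ (w.plus.map j).retractClosure ⊔
      (w.minus.map j).retractClosure) = ⊤ := by
  ext M
  refine ⟨fun _ => trivial, fun _ => ?_⟩
  obtain ⟨X, Y, f, g, h, hX, hY, hT⟩ := w'.exists_decomposition M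
  rw [hw'.le_eq hj] at hX
  rw [hw'.ge_eq hj] at hY
  refine (strongClosure _).ext_of_isTriangulatedClosed₂ _ hT
    (le_strongClosure _ _ (Or.inr (monotone_retractClosure (map_monotone ?_ j) _ hX)))
    ((strongClosure _).le_shift _ _
      (le_strongClosure _ _ (Or.inl (Or.inr (monotone_retractClosure (map_monotone ?_ j) _ hY)))))
  · exact fun X hX => ⟨0, w.le_shift_zero.2 hX⟩
  · exact fun X hX => ⟨0, w.ge_shift_zero.2 hX⟩

end

end WeightStructure

/-! ## Functors on idempotent completions -/

section KaroubiFunctor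

variable {A B : Type*} [Category* A] [Category* B]

/-- Each object of `Karoubi A` is a retract of one from `A`, so a morphism is recovered from its
conjugate in `A`; fullness follows in the same way. -/
lemma faithful_of_toKaroubi_comp (G : Karoubi A ⥤ B) [(toKaroubi A ⋙ G).Faithful] :
    G.Faithful where
  map_injective {P Q} f g hfg := by
    obtain ⟨f', hf'⟩ := (toKaroubi A).map_surjective (P.retract.r ≫ f ≫ Q.retract.i)
    obtain ⟨g', hg'⟩ := (toKaroubi A).map_surjective (P.retract.r ≫ g ≫ Q.retract.i)
    have h : f' = g' := (toKaroubi A ⋙ G).map_injective (by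
      rw [Functor.comp_map, Functor.comp_map, hf', hg']
      simp only [Functor.map_comp, hfg])
    have e := hf'.symm.trans ((congrArg _ h).trans hg')
    have e' := P.retract.i ≫= e =≫ Q.retract.r
    simpa only [Category.assoc, Retract.retract, Retract.retract_assoc, Category.comp_id] using e'

lemma full_of_toKaroubi_comp (G : Karoubi A ⥤ B) [(toKaroubi A ⋙ G).Full] : G.Full where
  map_surjective {P Q} h := by
    obtain ⟨u, hu⟩ := (toKaroubi A ⋙ G).map_surjective
      (G.map P.retract.r ≫ h ≫ G.map Q.retract.i)
    refine ⟨P.retract.i ≫ (toKaroubi A).map u ≫ Q.retract.r, ?_⟩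
    rw [Functor.comp_map] at hu
    rw [Functor.map_comp, Functor.map_comp, hu]
    simp only [Category.assoc, ← Functor.map_comp, ← Functor.map_comp_assoc, Retract.retract,
      CategoryTheory.Functor.map_id, Category.comp_id, Category.id_comp]

/-- The idempotent of the retract lifts along `F` to an idempotent `p` of `X`. Any extension of `F`
sends `(X, p)` to a splitting of the same idempotent, and splittings are unique. -/
lemma Retract.exists_karoubi {M : B} {X : A} (F : A ⥤ B) [F.Full] [F.Faithful]
    (ρ : Retract M (F.obj X)) :
    ∃ P : Karoubi A, P.X = X ∧ ∀ (G : Karoubi A ⥤ B) (_ : toKaroubi A ⋙ G ≅ F),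
      Nonempty (G.obj P ≅ M) := by
  obtain ⟨p, hp⟩ := F.map_surjective (ρ.r ≫ ρ.i)
  let P : Karoubi A := ⟨X, p, F.map_injective (by simp [hp])⟩
  refine ⟨P, rfl, fun G e => ?_⟩
  refine ⟨Retract.isoOfEq (P.retract.map G) (ρ.trans (Retract.ofIso (e.symm.app X))) ?_⟩
  have h1 : (toKaroubi A).map p = P.retract.r ≫ P.retract.i := Karoubi.decomp_p P
  have h2 := e.hom.naturality p
  rw [hp] at h2
  simp only [Retract.map_r, Retract.map_i, ← Functor.map_comp, ← h1, Retract.trans_i,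
    Retract.trans_r, Retract.ofIso]
  rw [← cancel_mono (e.hom.app X)]
  change _ ≫ e.hom.app X = ((e.hom.app X ≫ ρ.r) ≫ ρ.i ≫ e.inv.app X) ≫ e.hom.app X
  simpa using h2

end KaroubiFunctor

/-! ### Objects and generators of idempotent extensions. -/

section IdempotentExtension

variable {C : Type*} [Category* C] [Preadditive C] [HasZeroObject C] [HasShift C ℤ]
  [∀ n : ℤ, (shiftFunctor C n).Additive] [Pretriangulated C]
  {D : Type*} [Category* D] [Preadditive D] [HasZeroObject D] [HasShift D ℤ]
  [∀ n : ℤ, (shiftFunctor D n).Additive] [Pretriangulated D]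

lemma IsIdempotentExtension.exists_retract {j : C ⥤ D} [j.CommShift ℤ]
    (hj : IsIdempotentExtension j) (M : D) : ∃ X : C, Nonempty (Retract M (j.obj X)) := by
  obtain ⟨G, _, _, _, -, ⟨e⟩⟩ := hj.exists_embedding
  exact ⟨(G.obj M).X, ⟨Retract.preimage G
    ((G.obj M).retract.trans (Retract.ofIso (e.symm.app _)))⟩⟩

/-- A strict full triangulated subcategory of `Karoubi C` containing `C` is an idempotent
extension. -/
lemma isIdempotentExtension_lift (P : ObjectProperty (Karoubi C)) [P.IsTriangulated]
    (hP : ∀ X, P ((toKaroubi C).obj X)) :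
    IsIdempotentExtension (P.lift (toKaroubi C) hP) where
  full := inferInstance
  faithful := inferInstance
  exact := inferInstance
  exists_embedding := ⟨P.ι, inferInstance, inferInstance, inferInstance, inferInstance,
    ⟨P.liftCompιIso _ _⟩⟩

/-- This turns generation inside the ambient category into generation inside the subcategory: the
image of a strict triangulated subcategory of `P.FullSubcategory` is again strict and triangulated.
-/
lemma strongClosure_fullSubcategory_eq_top {G : ObjectProperty D}
    {P : ObjectProperty D} [P.IsTriangulated] (hP : P ≤ strongClosure G)
    {S : ObjectProperty P.FullSubcategory} (hS : G ≤ S.map P.ι) :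
    strongClosure S = ⊤ := by
  ext M
  refine ⟨fun _ => trivial, fun _ Q _ _ hQ => ?_⟩
  obtain ⟨N, hN, ⟨e⟩⟩ := hP _ M.property (Q.map P.ι) inferInstance inferInstance
    (hS.trans (ObjectProperty.map_monotone hQ P.ι))
  exact Q.prop_of_iso (P.ι.preimageIso e) hN

end IdempotentExtension

/-! ### The extensions `KarMin` and `KarMax`. -/

namespace WeightStructure

open ObjectProperty

variable {C : Type*} [Category* C] [Preadditive C] [HasZeroObject C] [HasShift C ℤ]
  [∀ n : ℤ, (shiftFunctor C n).Additive] [Pretriangulated C] (w : WeightStructure C)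

lemma karoubiObjects_of_retract {Q : ObjectProperty C} {P : ObjectProperty (Karoubi C)}
    [P.IsClosedUnderIsomorphisms] (h : karoubiObjects Q ≤ P) {M : Karoubi C} {X : C}
    (ρ : Retract M ((toKaroubi C).obj X)) (hX : Q X) : P M := by
  obtain ⟨K, hK, hK'⟩ := Retract.exists_karoubi (toKaroubi C) ρ
  obtain ⟨e⟩ := hK' (𝟭 _) (Functor.rightUnitor _)
  exact P.prop_of_iso e (h _ (show Q K.X from hK ▸ hX))

lemma heart_le_minus : w.heart ≤ w.minus := fun _ hX => ⟨0, w.le_shift_zero.2 hX.1⟩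

lemma heart_le_plus : w.heart ≤ w.plus := fun _ hX => ⟨0, w.ge_shift_zero.2 hX.2⟩

lemma karoubiObjects_heart_le_karMin : karoubiObjects w.heart ≤ w.karMin :=
  fun _ hX => le_strongClosure _ _ (Or.inr hX)

lemma karMin_le_karMax : w.karMin ≤ w.karMax := by
  refine strongClosure_le (sup_le ?_ fun X hX => le_strongClosure _ _
    (Or.inl (w.heart_le_minus _ hX)))
  rintro _ ⟨X, ⟨e⟩⟩
  exact w.karMax.prop_of_iso e (w.karMax_toKaroubi X)

section

variable (P : ObjectProperty (Karoubi C)) [P.IsTriangulated] [P.IsClosedUnderIsomorphisms]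
  (hP : ∀ X, P ((toKaroubi C).obj X)) {w}

lemma retractClosure_map_lift {Q : ObjectProperty C} {M : Karoubi C} (hM : P M)
    (hM' : karoubiObjects Q M) :
    (Q.map (P.lift (toKaroubi C) hP)).retractClosure.map P.ι M :=
  ⟨⟨M, hM⟩, prop_retractClosure (prop_map_obj _ _ hM')
    (Retract.preimage P.ι (Y := (P.lift (toKaroubi C) hP).obj M.X) M.retract), ⟨Iso.refl _⟩⟩

/-- An idempotent of the extended heart splits in `Karoubi C`. By `heart_eq` its image is a retract
of an object of `w.heart`, hence isomorphic to some `(X, p)` with `X` in that heart, and so it lies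
in `P`. -/
lemma isWeightKaroubian_of_karoubiObjects_heart_le (h : karoubiObjects w.heart ≤ P)
    {w' : WeightStructure P.FullSubcategory}
    (hw' : WeightExact (P.lift (toKaroubi C) hP) w w') : w'.IsWeightKaroubian where
  idempotents_split M p hp := by
    have hM : (w.heart.map (P.lift (toKaroubi C) hP)).retractClosure M.obj := by
      rw [← hw'.heart_eq (isIdempotentExtension_lift P hP).exists_retract]
      exact M.property
    obtain ⟨_, ⟨X, hX, ⟨e⟩⟩, ⟨ρ⟩⟩ := hM
    let ι := w'.heart.ι ⋙ P.ι
    obtain ⟨N, i, r, hir, hri⟩ := IsIdempotentComplete.idempotents_split (ι.obj M) (ι.map p)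
      (by rw [← Functor.map_comp, hp])
    let ρ' : Retract N ((toKaroubi C).obj X) := Retract.trans ⟨i, r, hir⟩
      ((ρ.trans (Retract.ofIso e.symm)).map P.ι)
    have hN : P N := karoubiObjects_of_retract h ρ' hX
    let N' : P.FullSubcategory := ⟨N, hN⟩
    let ρ₁ : Retract N' M.obj := Retract.preimage P.ι ⟨i, r, hir⟩
    have hN' : w'.heart N' :=
      ⟨w'.le_of_retract ρ₁ M.property.1, w'.ge_of_retract ρ₁ M.property.2⟩
    refine ⟨⟨N', hN'⟩, ι.preimage i, ι.preimage r, ι.map_injective ?_, ι.map_injective ?_⟩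
    · rw [Functor.map_comp, Functor.map_preimage, Functor.map_preimage,
        CategoryTheory.Functor.map_id]
      exact hir
    · rw [Functor.map_comp, Functor.map_preimage, Functor.map_preimage]
      exact hri

end

lemma isIdempotentExtension_toKarMin : IsIdempotentExtension w.toKarMin :=
  isIdempotentExtension_lift _ _

lemma isIdempotentExtension_toKarMax : IsIdempotentExtension w.toKarMax :=
  isIdempotentExtension_lift _ _

/-- Objects of the heart are bounded, so the added generators are retracts of objects of `w.plus`
and the existence criterion applies. -/
lemma exists_extension_karMin [IsTriangulated C] :
    ∃ wm : WeightStructure w.KarMin, WeightExact w.toKarMin w wm := by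
  refine w.exists_extension_of_strongClosure_eq_top w.toKarMin
    w.isIdempotentExtension_toKarMin.exists_retract le_rfl le_rfl
    (strongClosure_fullSubcategory_eq_top (P := w.karMin) le_rfl ?_)
  rintro M (⟨X, ⟨e⟩⟩ | hM)
  · exact ⟨_, Or.inl (Or.inl (w.toKarMin.obj_mem_essImage X)), ⟨e⟩⟩
  · obtain ⟨N, hN, e⟩ := retractClosure_map_lift (Q := w.plus) w.karMin w.karMin_toKaroubi
      (le_strongClosure _ _ (Or.inr hM)) (w.heart_le_plus _ hM)
    exact ⟨N, Or.inl (Or.inr hN), e⟩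

lemma exists_extension_karMax [IsTriangulated C] :
    ∃ wM : WeightStructure w.KarMax, WeightExact w.toKarMax w wM := by
  refine w.exists_extension_of_strongClosure_eq_top w.toKarMax
    w.isIdempotentExtension_toKarMax.exists_retract le_rfl le_rfl
    (strongClosure_fullSubcategory_eq_top (P := w.karMax) le_rfl ?_)
  rintro M (hM | hM)
  · obtain ⟨N, hN, e⟩ := retractClosure_map_lift w.karMax w.karMax_toKaroubi
      (le_strongClosure _ _ (Or.inl hM)) hM
    exact ⟨N, Or.inr hN, e⟩
  · obtain ⟨N, hN, e⟩ := retractClosure_map_lift w.karMax w.karMax_toKaroubi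
      (le_strongClosure _ _ (Or.inr hM)) hM
    exact ⟨N, Or.inl (Or.inr hN), e⟩

/-! ### Comparison of extensions. -/

variable {w} {D : Type*} [Category* D] [Preadditive D] [HasZeroObject D] [HasShift D ℤ]
  [∀ n : ℤ, (shiftFunctor D n).Additive] [Pretriangulated D]
  {j : C ⥤ D} [j.CommShift ℤ] {w' : WeightStructure D}

lemma WeightExact.unique [j.IsTriangulated] {w₁ w₂ : WeightStructure D}
    (hj : ∀ M : D, ∃ X : C, Nonempty (Retract M (j.obj X)))
    (h₁ : WeightExact j w w₁) (h₂ : WeightExact j w w₂) : w₁ = w₂ :=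
  WeightStructure.ext ((h₁.le_eq hj).trans (h₂.le_eq hj).symm)
    ((h₁.ge_eq hj).trans (h₂.ge_eq hj).symm)

/-- The extended weight structures on two idempotent extensions are compatible with any functor
between them which is compatible with the embeddings. -/
lemma WeightExact.of_comp_iso [j.IsTriangulated]
    (hj : ∀ M : D, ∃ X : C, Nonempty (Retract M (j.obj X))) (hw' : WeightExact j w w')
    {D' : Type*} [Category* D'] [Preadditive D'] [HasZeroObject D'] [HasShift D' ℤ]
    [∀ n : ℤ, (shiftFunctor D' n).Additive] [Pretriangulated D'] {j' : C ⥤ D'}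
    {w'' : WeightStructure D'} (hw'' : WeightExact j' w w'') {F : D ⥤ D'} (e : j ⋙ F ≅ j') :
    WeightExact F w' w'' := by
  constructor
  · intro M hM
    rw [hw'.le_eq hj] at hM
    obtain ⟨_, ⟨X, hX, ⟨e'⟩⟩, ⟨ρ⟩⟩ := hM
    exact w''.le_of_retract (((ρ.trans (Retract.ofIso e'.symm)).map F).trans
      (Retract.ofIso (e.app X))) (hw''.1 _ hX)
  · intro M hM
    rw [hw'.ge_eq hj] at hM
    obtain ⟨_, ⟨X, hX, ⟨e'⟩⟩, ⟨ρ⟩⟩ := hM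
    exact w''.ge_of_retract (((ρ.trans (Retract.ofIso e'.symm)).map F).trans
      (Retract.ofIso (e.app X))) (hw''.2 _ hX)

/-- The heart of a weight-Karoubian extension is the idempotent completion of the heart. -/
theorem WeightExact.exists_karoubi_heart_equivalence [j.IsTriangulated] [j.Full] [j.Faithful]
    (hj : ∀ M : D, ∃ X : C, Nonempty (Retract M (j.obj X))) (hw' : WeightExact j w w')
    (hK : w'.IsWeightKaroubian) :
    ∃ e : Karoubi w.Heart ≌ w'.Heart,
      Nonempty (toKaroubi w.Heart ⋙ e.functor ⋙ w'.heart.ι ≅ w.heart.ι ⋙ j) := by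
  have : IsIdempotentComplete w'.Heart := hK
  have hF (X : w.Heart) : w'.heart ((w.heart.ι ⋙ j).obj X) :=
    ⟨hw'.1 _ X.property.1, hw'.2 _ X.property.2⟩
  let F : w.Heart ⥤ w'.Heart := w'.heart.lift (w.heart.ι ⋙ j) hF
  have : F.Full := inferInstanceAs (w'.heart.lift (w.heart.ι ⋙ j) hF).Full
  have : F.Faithful := inferInstanceAs (w'.heart.lift (w.heart.ι ⋙ j) hF).Faithful
  let W := (Functor.whiskeringLeft w.Heart (Karoubi w.Heart) w'.Heart).obj (toKaroubi w.Heart)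
  -- As the target is idempotent complete, restriction along `toKaroubi` is essentially surjective
  -- on functors, which extends `F` to the completion.
  let G : Karoubi w.Heart ⥤ w'.Heart := W.objPreimage F
  let e : toKaroubi w.Heart ⋙ G ≅ F := W.objObjPreimageIso F
  have : (toKaroubi w.Heart ⋙ G).Full := Functor.Full.of_iso e.symm
  have : (toKaroubi w.Heart ⋙ G).Faithful := Functor.Faithful.of_iso e.symm
  have := full_of_toKaroubi_comp G
  have := faithful_of_toKaroubi_comp G
  have : G.EssSurj := ⟨fun M => by
    have hM : (w.heart.map j).retractClosure M.obj := by
      rw [← hw'.heart_eq hj]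
      exact M.property
    obtain ⟨_, ⟨X, hX, ⟨e'⟩⟩, ⟨ρ⟩⟩ := hM
    let ρ' : Retract M (F.obj ⟨X, hX⟩) :=
      Retract.preimage w'.heart.ι (ρ.trans (Retract.ofIso e'.symm))
    obtain ⟨P, -, hP⟩ := Retract.exists_karoubi F ρ'
    exact ⟨P, hP G e⟩⟩
  have : G.IsEquivalence := {}
  exact ⟨G.asEquivalence, ⟨(Functor.associator _ _ _).symm ≪≫
    Functor.isoWhiskerRight e w'.heart.ι⟩⟩

/-- The ends of a `w'`-decomposition are retracts of objects of `C⁻` and `C⁺` (up to a shift), so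
the embedding into `Karoubi C` lands in `karMax`. -/
theorem WeightExact.exists_functor_to_karMax [IsTriangulated C]
    (hj : IsIdempotentExtension j) (hw' : WeightExact j w w') :
    ∃ (F : D ⥤ w.KarMax) (_ : F.CommShift ℤ),
      F.Full ∧ F.Faithful ∧ F.IsTriangulated ∧ Nonempty (j ⋙ F ≅ w.toKarMax) ∧
      ∀ wM : WeightStructure w.KarMax, WeightExact w.toKarMax w wM → WeightExact F w' wM := by
  have := hj.exact
  obtain ⟨G, _, _, _, _, ⟨e⟩⟩ := hj.exists_embedding
  have hG (M : D) : w.karMax (G.obj M) := by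
    obtain ⟨X, Y, f, g, h, hX, hY, hT⟩ := w'.exists_decomposition M
    rw [hw'.le_eq hj.exists_retract] at hX
    rw [hw'.ge_eq hj.exists_retract] at hY
    obtain ⟨_, ⟨X', hX', ⟨eX⟩⟩, ⟨ρX⟩⟩ := hX
    obtain ⟨_, ⟨Y', hY', ⟨eY⟩⟩, ⟨ρY⟩⟩ := hY
    refine w.karMax.ext_of_isTriangulatedClosed₂ _ (G.map_distinguished _ hT) ?_ ?_
    · exact karoubiObjects_of_retract (Q := w.minus) (P := w.karMax)
        (fun _ h => le_strongClosure _ _ (Or.inl h))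
        (((ρX.trans (Retract.ofIso eX.symm)).map G).trans (Retract.ofIso (e.app X')))
        ⟨0, w.le_shift_zero.2 hX'⟩
    · refine w.karMax.prop_of_iso ((G.commShiftIso (1 : ℤ)).symm.app Y)
        (w.karMax.le_shift (1 : ℤ) (G.obj Y) ?_)
      exact karoubiObjects_of_retract (Q := w.plus) (P := w.karMax)
        (fun _ h => le_strongClosure _ _ (Or.inr h))
        (((ρY.trans (Retract.ofIso eY.symm)).map G).trans (Retract.ofIso (e.app Y')))
        ⟨0, w.ge_shift_zero.2 hY'⟩
  have e' : j ⋙ w.karMax.lift G hG ≅ w.toKarMax :=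
    Functor.fullyFaithfulCancelRight w.karMax.ι e
  exact ⟨w.karMax.lift G hG, inferInstance, inferInstance, inferInstance, inferInstance, ⟨e'⟩,
    fun wM hwM => hw'.of_comp_iso hj.exists_retract hwM e'⟩

theorem WeightExact.exists_functor_from_karMin [IsTriangulated C]
    (hj : IsIdempotentExtension j) (hw' : WeightExact j w w') (hK : w'.IsWeightKaroubian) :
    ∃ (F : w.KarMin ⥤ D) (_ : F.CommShift ℤ),
      F.Full ∧ F.Faithful ∧ F.IsTriangulated ∧ Nonempty (w.toKarMin ⋙ F ≅ j) ∧
      ∀ wm : WeightStructure w.KarMin, WeightExact w.toKarMin w wm → WeightExact F wm w' := by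
  have := hj.exact
  have := hj.full
  have := hj.faithful
  obtain ⟨G, _, _, _, _, ⟨e⟩⟩ := hj.exists_embedding
  have hG : w.karMin ≤ G.essImage := by
    refine strongClosure_le (sup_le ?_ fun P hP => ?_)
    · rintro _ ⟨X, ⟨e'⟩⟩
      exact ⟨j.obj X, ⟨e.app X ≪≫ e'⟩⟩
    -- For `P` in the completed heart, its idempotent already splits in the heart of `w'`; `G` sends
    -- that splitting to an object isomorphic to `P`.
    · have hK' : IsIdempotentComplete w'.Heart := hK
      let H : w'.Heart := ⟨j.obj P.X, hw'.1 _ hP.1, hw'.2 _ hP.2⟩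
      let q : H ⟶ H := homMk (j.map P.p)
      obtain ⟨N, i, r, hir, hri⟩ := IsIdempotentComplete.idempotents_split H q
        (w'.heart.ι.map_injective (show j.map P.p ≫ j.map P.p = j.map P.p by
          rw [← Functor.map_comp, P.idem]))
      let ι := w'.heart.ι ⋙ G
      refine ⟨N.obj, ⟨Retract.isoOfEq
        (((⟨i, r, hir⟩ : Retract N H).map ι).trans (Retract.ofIso (e.app P.X))) P.retract ?_⟩⟩
      have h1 : P.retract.r ≫ P.retract.i = (toKaroubi C).map P.p := (Karoubi.decomp_p P).symm
      have h2 : ι.map r ≫ ι.map i = G.map (j.map P.p) := by rw [← Functor.map_comp, hri]; rfl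
      have h3 := e.hom.naturality P.p
      rw [h1]
      change (e.inv.app P.X ≫ ι.map r) ≫ ι.map i ≫ e.hom.app P.X = _
      rw [Category.assoc, reassoc_of% h2]
      exact (Iso.inv_comp_eq (e.app P.X)).2 h3
  let F : w.KarMin ⥤ D :=
    Functor.essImage.liftFunctor w.karMin.ι G (fun M => hG _ M.property)
  let eF : F ⋙ G ≅ w.karMin.ι :=
    Functor.essImage.liftFunctorCompIso w.karMin.ι G (fun M => hG _ M.property)
  -- The lift `F` is defined only up to the isomorphism `eF`, so its shift compatibility and
  -- exactness are both inherited from the inclusion through the fully faithful `G`.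
  let _ : F.CommShift ℤ := Functor.CommShift.ofComp eF ℤ
  have : NatTrans.CommShift eF.hom ℤ := Functor.CommShift.ofComp_compatibility eF ℤ
  have e' : w.toKarMin ⋙ F ≅ j := Functor.fullyFaithfulCancelRight G
    (Functor.associator _ _ _ ≪≫ Functor.isoWhiskerLeft w.toKarMin eF ≪≫ e.symm)
  exact ⟨F, inferInstance, Functor.Full.of_comp_faithful_iso eF,
    Functor.Faithful.of_comp_iso eF,
    (Functor.isTriangulated_iff_comp_right eF).2 inferInstance, ⟨e'⟩,
    fun wm hwm => hwm.of_comp_iso w.isIdempotentExtension_toKarMin.exists_retract hw' e'⟩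

end WeightStructure

theorem theorem2p2p2
    {C : Type*} [Category* C] [Preadditive C] [HasZeroObject C] [HasShift C ℤ]
    [∀ n : ℤ, (shiftFunctor C n).Additive] [Pretriangulated C] [IsTriangulated C]
    (w : WeightStructure C)
    {C' : Type*} [Category* C'] [Preadditive C'] [HasZeroObject C'] [HasShift C' ℤ]
    [∀ n : ℤ, (shiftFunctor C' n).Additive] [Pretriangulated C'] [IsTriangulated C']
    (j : C ⥤ C') [j.CommShift ℤ] (hj : IsIdempotentExtension j) :
    -- I.1: description of an extension `w'` of `w` to `C'`, and its uniqueness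
    (∀ w' : WeightStructure C', WeightStructure.WeightExact j w w' →
      w'.le = (w.le.map j).retractClosure ∧
      w'.ge = (w.ge.map j).retractClosure ∧
      w'.heart = (w.heart.map j).retractClosure) ∧
    (∀ w₁ w₂ : WeightStructure C', WeightStructure.WeightExact j w w₁ → WeightStructure.WeightExact j w w₂ → w₁ = w₂) ∧
    -- I.2: existence criterion
    ((∃ w' : WeightStructure C', WeightStructure.WeightExact j w w') ↔
      ∃ C₁ C₂ : ObjectProperty C',
        C₁ ≤ (w.plus.map j).retractClosure ∧ C₂ ≤ (w.minus.map j).retractClosure ∧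
        strongClosure (j.essImage ⊔ C₁ ⊔ C₂) = ⊤) ∧
    -- II.1
    (∀ w' : WeightStructure C', WeightStructure.WeightExact j w w' →
      (w'.IsBoundedBelow ↔ w.IsBoundedBelow) ∧ (w'.IsBoundedAbove ↔ w.IsBoundedAbove)) ∧
    -- II.2
    (w.IsBoundedBelow ∨ w.IsBoundedAbove → ∃ w' : WeightStructure C', WeightStructure.WeightExact j w w') ∧
    -- III.1: the weight-Karoubian extensions `Kar^w_min(C) ⊆ Kar^w_max(C)`
    (w.karMin ≤ w.karMax ∧
      IsIdempotentExtension w.toKarMin ∧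
      (∃! wm : WeightStructure w.KarMin, WeightStructure.WeightExact w.toKarMin w wm) ∧
      (∀ wm : WeightStructure w.KarMin, WeightStructure.WeightExact w.toKarMin w wm → wm.IsWeightKaroubian) ∧
      IsIdempotentExtension w.toKarMax ∧
      (∃! wM : WeightStructure w.KarMax, WeightStructure.WeightExact w.toKarMax w wM) ∧
      (∀ wM : WeightStructure w.KarMax, WeightStructure.WeightExact w.toKarMax w wM → wM.IsWeightKaroubian)) ∧
    -- III.2: the heart of a weight-Karoubian extension
    (∀ w' : WeightStructure C', WeightStructure.WeightExact j w w' → w'.IsWeightKaroubian →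
      ∃ e : Karoubi w.Heart ≌ w'.Heart,
        Nonempty (toKaroubi w.Heart ⋙ e.functor ⋙ w'.heart.ι ≅ w.heart.ι ⋙ j)) ∧
    -- III.3: maximality of `Kar^w_max(C)`
    (∀ w' : WeightStructure C', WeightStructure.WeightExact j w w' →
      ∃ (F : C' ⥤ w.KarMax) (_ : F.CommShift ℤ),
        F.Full ∧ F.Faithful ∧ F.IsTriangulated ∧ Nonempty (j ⋙ F ≅ w.toKarMax) ∧
        ∀ wM : WeightStructure w.KarMax, WeightStructure.WeightExact w.toKarMax w wM → WeightStructure.WeightExact F w' wM) ∧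
    -- III.4: minimality of `Kar^w_min(C)`
    (∀ w' : WeightStructure C', WeightStructure.WeightExact j w w' → w'.IsWeightKaroubian →
      ∃ (F : w.KarMin ⥤ C') (_ : F.CommShift ℤ),
        F.Full ∧ F.Faithful ∧ F.IsTriangulated ∧ Nonempty (w.toKarMin ⋙ F ≅ j) ∧
        ∀ wm : WeightStructure w.KarMin, WeightStructure.WeightExact w.toKarMin w wm → WeightStructure.WeightExact F wm w') := by
  have := hj.full
  have := hj.faithful
  have := hj.exact
  have hr := hj.exists_retract
  refine ⟨fun w' hw' => ⟨hw'.le_eq hr, hw'.ge_eq hr, hw'.heart_eq hr⟩,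
    fun w₁ w₂ h₁ h₂ => h₁.unique hr h₂, ⟨?_, ?_⟩,
    fun w' hw' => ⟨hw'.isBoundedBelow_iff hr, hw'.isBoundedAbove_iff hr⟩, ?_,
    ⟨w.karMin_le_karMax, w.isIdempotentExtension_toKarMin, ?_, ?_,
      w.isIdempotentExtension_toKarMax, ?_, ?_⟩,
    fun w' hw' hK => hw'.exists_karoubi_heart_equivalence hr hK,
    fun w' hw' => hw'.exists_functor_to_karMax hj,
    fun w' hw' hK => hw'.exists_functor_from_karMin hj hK⟩
  · rintro ⟨w', hw'⟩
    -- The witnesses are the largest admissible classes, namely all retracts of bounded below and of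
    -- bounded above objects.
    exact ⟨_, _, le_rfl, le_rfl, hw'.strongClosure_eq_top hr⟩
  · rintro ⟨C₁, C₂, h₁, h₂, h⟩
    exact w.exists_extension_of_strongClosure_eq_top j hr h₁ h₂ h
  · exact w.exists_extension_of_isBounded j hr
  · obtain ⟨wm, hwm⟩ := w.exists_extension_karMin
    exact ⟨wm, hwm, fun _ h => h.unique w.isIdempotentExtension_toKarMin.exists_retract hwm⟩
  · exact fun wm hwm => WeightStructure.isWeightKaroubian_of_karoubiObjects_heart_le _ _
      w.karoubiObjects_heart_le_karMin hwm
  · obtain ⟨wM, hwM⟩ := w.exists_extension_karMax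
    exact ⟨wM, hwM, fun _ h => h.unique w.isIdempotentExtension_toKarMax.exists_retract hwM⟩
  · exact fun wM hwM => WeightStructure.isWeightKaroubian_of_karoubiObjects_heart_le _ _
      (w.karoubiObjects_heart_le_karMin.trans w.karMin_le_karMax) hwM
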